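/- Let $k$ be a commutative ring and $H$ a Hopf algebra over $k$ that is projective as a $k$-module (for example, any Hopf algebra, of finite or infinite dimension, over a field $k$). Let $A$ be a right $H$-comodule algebra with coaction $a\mapsto a_{(0)}\otimes a_{(1)}$, an algebra homomorphism $A\to A\otimes_k H$, and let $B=\{b\in A : b_{(0)}\otimes b_{(1)}=b\otimes 1\}$ be its subalgebra of coinvariants (so $A\,|\,B$ is a right $H$-extension). Suppose that the Galois map $\beta: A\otimes_B A\to A\otimes_k H$, $\beta(x\otimes y)=xy_{(0)}\otimes y_{(1)}$, is a split monomorphism of $A$-$B$-bimodules, where $a\cdot(x\otimes h)\cdot b=axb\otimes h$ on $A\otimes_k H$. Let $R=C_A(B)$ be the centralizer of $B$ in $A$, and let $T=(A\otimes_B A)^B$ be the set of $B$-central elements $t=t^1\otimes t^2$ (sums suppressed), an algebra with product $tu=u^1t^1\otimes t^2u^2$ and unit $1\otimes 1$. Then: 1. $A\,|\,B$ is right depth two: as an $A$-$B$-bimodule, $A\otimes_B A$ is isomorphic to a direct summand of a direct sum $A^{(I)}$ for some set $I$. Moreover it has a right D2 quasibase: there are a set $I$, $B$-$B$-bimodule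 endomorphisms $\gamma_i$ of $A$ and elements $u_i\in T$ $(i\in I)$ such that for each $a\in A$ one has $\gamma_i(a)=0$ for all but finitely many $i$, and $x\otimes y=\sum_i x\gamma_i(y)u_i$ for all $x,y\in A$. 2. $T$ is a right bialgebroid over $R$ with source $s_R(r)=1\otimes r$, target $t_R(r)=r\otimes 1$ (an anti-homomorphism), bimodule structure $r\cdot t\cdot r'=t\,t_R(r)s_R(r')=rt^1\otimes t^2r'$, counit $\varepsilon(t)=t^1t^2$ and coproduct $\Delta(t)=\sum_i(t^1\otimes\gamma_i(t^2))\otimes_R u_i$, which is the same for every right D2 quasibase. 3. $A\,|\,B$ is a right $T$-Galois extension: with the inclusion $R\to A$ and the coaction $\delta_T(a)=\sum_i\gamma_i(a)\otimes_R u_i\in A\otimes_R T$ (again the same for every right D2 quasibase), $A$ is a right $T$-comodule algebra, its set of coinvariants $\{a\in A:\delta_T(a)=a\otimes_R 1_T\}$ is $B$, and the Galois map $A\otimes_B A\to A\otimes_R T$, $x\otimes y\mapsto x\,\delta_T(y)$, is bijective. -/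

import Mathlib

open scoped TensorProduct
open MulOpposite

universe u v w

section RelativeTensor

variable {k : Type*} [CommRing k] {S M N P M' N' : Type*}
  [AddCommGroup M] [Module k M] [AddCommGroup N] [Module k N] [AddCommGroup P] [Module k P]
  [AddCommGroup M'] [Module k M'] [AddCommGroup N'] [Module k N']

/-- The relations `(m · s) ⊗ n = m ⊗ (s · n)`. -/
def balancedRel (ρ : S → Module.End k M) (l : S → Module.End k N) : Submodule k (M ⊗[k] N) :=
  Submodule.span k {z | ∃ s m n, z = ρ s m ⊗ₜ[k] n - m ⊗ₜ[k] l s n}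

/-- The tensor product `M ⊗_S N` over a (possibly noncommutative) `k`-algebra `S`, where
`ρ s` is the right action of `s` on `M` and `l s` is the left action of `s` on `N`:
the quotient of `M ⊗[k] N` by the `S`-balancing relations. -/
def RelTensor (ρ : S → Module.End k M) (l : S → Module.End k N) : Type _ :=
  (M ⊗[k] N) ⧸ balancedRel ρ l

namespace RelTensor

variable (ρ : S → Module.End k M) (l : S → Module.End k N)

instance : AddCommGroup (RelTensor ρ l) :=
  inferInstanceAs (AddCommGroup ((M ⊗[k] N) ⧸ balancedRel ρ l))

instance : Module k (RelTensor ρ l) :=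
  inferInstanceAs (Module k ((M ⊗[k] N) ⧸ balancedRel ρ l))

/-- The projection `M ⊗[k] N → M ⊗_S N`. -/
def mk : M ⊗[k] N →ₗ[k] RelTensor ρ l := (balancedRel ρ l).mkQ

theorem mk_surjective : Function.Surjective (mk ρ l) := (balancedRel ρ l).mkQ_surjective

/-- The class of the pure tensor `m ⊗ n`. -/
def tmul (m : M) (n : N) : RelTensor ρ l := mk ρ l (m ⊗ₜ[k] n)

theorem tmul_balanced (s : S) (m : M) (n : N) :
    tmul ρ l (ρ s m) n = tmul ρ l m (l s n) := by
  refine (Submodule.Quotient.eq (balancedRel ρ l)).2 ?_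
  exact Submodule.subset_span ⟨s, m, n, rfl⟩

theorem tmul_add (m : M) (n n' : N) :
    tmul ρ l m (n + n') = tmul ρ l m n + tmul ρ l m n' := by
  simp [tmul, TensorProduct.tmul_add]

theorem add_tmul (m m' : M) (n : N) :
    tmul ρ l (m + m') n = tmul ρ l m n + tmul ρ l m' n := by
  simp [tmul, TensorProduct.add_tmul]

theorem tmul_smul (c : k) (m : M) (n : N) : tmul ρ l m (c • n) = c • tmul ρ l m n := by
  simp [tmul]

theorem smul_tmul (c : k) (m : M) (n : N) : tmul ρ l (c • m) n = c • tmul ρ l m n := by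
  rw [tmul, ← TensorProduct.smul_tmul', map_smul, tmul]

@[simp] theorem tmul_zero (m : M) : tmul ρ l m 0 = 0 := by simp [tmul]

@[simp] theorem zero_tmul (n : N) : tmul ρ l 0 n = 0 := by simp [tmul]

variable {ρ l}

theorem induction {p : RelTensor ρ l → Prop} (h0 : p 0) (ht : ∀ m n, p (tmul ρ l m n))
    (ha : ∀ x y, p x → p y → p (x + y)) (z : RelTensor ρ l) : p z := by
  obtain ⟨z, rfl⟩ := mk_surjective ρ l z
  induction z with
  | zero => simpa using h0
  | tmul m n => exact ht m n
  | add x y hx hy => simpa using ha _ _ hx hy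

/-- A balanced bilinear map factors through the relative tensor product. -/
def lift (f : M →ₗ[k] N →ₗ[k] P) (hf : ∀ s m n, f (ρ s m) n = f m (l s n)) :
    RelTensor ρ l →ₗ[k] P :=
  (balancedRel ρ l).liftQ (TensorProduct.lift f) (by
    refine Submodule.span_le.2 ?_
    rintro _ ⟨s, m, n, rfl⟩
    simp [hf])

@[simp] theorem lift_tmul (f : M →ₗ[k] N →ₗ[k] P) (hf : ∀ s m n, f (ρ s m) n = f m (l s n))
    (m : M) (n : N) : lift f hf (tmul ρ l m n) = f m n := by
  change TensorProduct.lift f (m ⊗ₜ n) = f m n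
  simp

theorem hom_ext {f g : RelTensor ρ l →ₗ[k] P}
    (h : ∀ m n, f (tmul ρ l m n) = g (tmul ρ l m n)) : f = g := by
  ext z
  induction z using RelTensor.induction with
  | h0 => simp
  | ht m n => exact h m n
  | ha x y hx hy => simp [hx, hy]

variable (ρ l) in
/-- The universal balanced bilinear map `(m, n) ↦ m ⊗ n`. -/
def mkBilin : M →ₗ[k] N →ₗ[k] RelTensor ρ l :=
  LinearMap.mk₂ k (tmul ρ l) (add_tmul ρ l) (smul_tmul ρ l) (tmul_add ρ l) (tmul_smul ρ l)

@[simp] theorem mkBilin_apply (m : M) (n : N) : mkBilin ρ l m n = tmul ρ l m n := rfl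

/-- `f ⊗ g` for a right `S`-linear map `f` and a left `S`-linear map `g`. -/
def map {ρ' : S → Module.End k M'} {l' : S → Module.End k N'} (f : M →ₗ[k] M') (g : N →ₗ[k] N')
    (hf : ∀ s m, f (ρ s m) = ρ' s (f m)) (hg : ∀ s n, g (l s n) = l' s (g n)) :
    RelTensor ρ l →ₗ[k] RelTensor ρ' l' :=
  lift ((mkBilin ρ' l').compl₁₂ f g) (by
    intro s m n
    simp only [LinearMap.compl₁₂_apply, mkBilin_apply, hf, hg]
    exact tmul_balanced ρ' l' s _ _)

@[simp] theorem map_tmul {ρ' : S → Module.End k M'} {l' : S → Module.End k N'}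
    (f : M →ₗ[k] M') (g : N →ₗ[k] N')
    (hf : ∀ s m, f (ρ s m) = ρ' s (f m)) (hg : ∀ s n, g (l s n) = l' s (g n)) (m : M) (n : N) :
    map f g hf hg (tmul ρ l m n) = tmul ρ' l' (f m) (g n) := by
  simp [map]

end RelTensor

end RelativeTensor

/-! ### Right bialgebroids and their comodule algebras -/

section Bialgebroid

variable {k R T M A : Type*} [CommRing k] [Ring R] [Algebra k R] [Ring T] [Algebra k T]
  [Ring M] [Algebra k M] [Ring A] [Algebra k A]

/-- The right `R`-action `m · r = m η(r)` on an algebra `M` with an algebra map `η : R → M`. -/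
def rAct (η : R →ₐ[k] M) (r : R) : Module.End k M := LinearMap.mulRight k (η r)

/-- The left `R`-action `r · x = x t(r)` on an algebra `T` with an algebra
anti-homomorphism `t : R → T`. -/
def lAct (t : Rᵐᵒᵖ →ₐ[k] T) (r : R) : Module.End k T := LinearMap.mulRight k (t (op r))

/-- `M ⊗_R T`, with `(m η(r)) ⊗ x = m ⊗ (x t(r))`. -/
abbrev TensorR (η : R →ₐ[k] M) (t : Rᵐᵒᵖ →ₐ[k] T) : Type _ := RelTensor (rAct η) (lAct t)

namespace TensorR

variable (η : R →ₐ[k] M) (s : R →ₐ[k] T) (t : Rᵐᵒᵖ →ₐ[k] T)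

/-- Left multiplication on the first factor: `m ⊗ x ↦ (a m) ⊗ x`. -/
def mulFst (a : M) : TensorR η t →ₗ[k] TensorR η t :=
  RelTensor.map (LinearMap.mulLeft k a) LinearMap.id
    (by intros; simp [rAct, mul_assoc]) (by intros; rfl)

@[simp] theorem mulFst_tmul (a m : M) (x : T) :
    mulFst η t a (RelTensor.tmul _ _ m x) = RelTensor.tmul _ _ (a * m) x :=
  RelTensor.map_tmul _ _ _ _ m x

/-- Left multiplication on the second factor: `m ⊗ x ↦ m ⊗ (y x)`. -/
def mulSnd (y : T) : TensorR η t →ₗ[k] TensorR η t :=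
  RelTensor.map LinearMap.id (LinearMap.mulLeft k y)
    (by intros; rfl) (by intros; simp [lAct, mul_assoc])

variable {s t}

/-- The right `R`-action `(m ⊗ x) · r = m ⊗ (x s(r))` on `M ⊗_R T`. -/
def right (hst : ∀ r r', s r * t (op r') = t (op r') * s r) (r : R) :
    Module.End k (TensorR η t) :=
  RelTensor.map LinearMap.id (rAct s r) (by intros; rfl)
    (by intros; simp [rAct, lAct, mul_assoc, hst])

/-- The left `R`-action `r · (x ⊗ y) = (x t(r)) ⊗ y` on `T ⊗_R T`. -/
def left (hst : ∀ r r', s r * t (op r') = t (op r') * s r) (r : R) :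
    Module.End k (TensorR s t) :=
  RelTensor.map (lAct t r) LinearMap.id
    (by intros; simp [rAct, lAct, mul_assoc, hst]) (by intros; rfl)

@[simp] theorem right_tmul (hst : ∀ r r', s r * t (op r') = t (op r') * s r) (r : R) (m : M)
    (x : T) : right η hst r (RelTensor.tmul _ _ m x) = RelTensor.tmul _ _ m (x * s r) :=
  RelTensor.map_tmul _ _ _ _ m x

@[simp] theorem left_tmul (hst : ∀ r r', s r * t (op r') = t (op r') * s r) (r : R) (x y : T) :
    left hst r (RelTensor.tmul _ _ x y) = RelTensor.tmul _ _ (x * t (op r)) y :=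
  RelTensor.map_tmul _ _ _ _ x y

/-- `(M ⊗_R T) ⊗_R T`. -/
abbrev Triple (hst : ∀ r r', s r * t (op r') = t (op r') * s r) : Type _ :=
  RelTensor (right η hst) (lAct t)

/-- `δ ⊗ id : M ⊗_R T → M ⊗_R T ⊗_R T` for a right `R`-linear `δ : M → M ⊗_R T`. -/
def mapFst (hst : ∀ r r', s r * t (op r') = t (op r') * s r) (δ : M →ₗ[k] TensorR η t)
    (hδ : ∀ m r, δ (m * η r) = right η hst r (δ m)) : TensorR η t →ₗ[k] Triple η hst :=
  RelTensor.map δ LinearMap.id (by intro r m; exact hδ m r) (by intros; rfl)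

/-- `x ⊗ y ↦ (m ⊗ x) ⊗ y`. -/
def assocAt (hst : ∀ r r', s r * t (op r') = t (op r') * s r) (m : M) :
    TensorR s t →ₗ[k] Triple η hst :=
  RelTensor.map (RelTensor.mkBilin (rAct η) (lAct t) m) LinearMap.id
    (by intro r x; exact (right_tmul η hst r m x).symm) (by intros; rfl)

@[simp] theorem assocAt_tmul (hst : ∀ r r', s r * t (op r') = t (op r') * s r) (m : M) (x y : T) :
    assocAt η hst m (RelTensor.tmul _ _ x y) =
      RelTensor.tmul _ _ (RelTensor.tmul _ _ m x) y :=
  RelTensor.map_tmul _ _ _ _ x y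

/-- `x ⊗ y ↦ (m ⊗ x) ⊗ y`, linear in `m`. -/
def assocBilin (hst : ∀ r r', s r * t (op r') = t (op r') * s r) :
    M →ₗ[k] TensorR s t →ₗ[k] Triple η hst where
  toFun m := assocAt η hst m
  map_add' m m' := RelTensor.hom_ext fun x y => by simp [RelTensor.add_tmul]
  map_smul' c m := RelTensor.hom_ext fun x y => by simp [RelTensor.smul_tmul]

/-- `id ⊗ Δ : M ⊗_R T → M ⊗_R T ⊗_R T` for a left `R`-linear `Δ : T → T ⊗_R T`. -/
def mapSnd (hst : ∀ r r', s r * t (op r') = t (op r') * s r) (Δ : T →ₗ[k] TensorR s t)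
    (hΔ : ∀ x r, Δ (x * t (op r)) = left hst r (Δ x)) : TensorR η t →ₗ[k] Triple η hst :=
  RelTensor.lift ((assocBilin η hst).compl₁₂ LinearMap.id Δ) (by
    intro r m x
    have h : assocAt η hst (m * η r) = assocAt η hst m ∘ₗ left hst r := by
      refine RelTensor.hom_ext fun y z => ?_
      have := RelTensor.tmul_balanced (rAct η) (lAct t) r m y
      simp only [LinearMap.comp_apply, left_tmul, assocAt_tmul]
      exact congrArg (fun w => RelTensor.tmul (right η hst) (lAct t) w z) this
    have h2 := LinearMap.congr_fun h (Δ x)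
    simpa [rAct, lAct, hΔ, assocBilin] using h2)

/-- `m ⊗ x ↦ m · ε(x)`. -/
def counitSnd (ε : T →ₗ[k] R) (hε : ∀ x r, ε (x * t (op r)) = r * ε x) :
    TensorR η t →ₗ[k] M :=
  RelTensor.lift ((LinearMap.mul k M).compl₁₂ LinearMap.id (η.toLinearMap ∘ₗ ε))
    (by intros; simp [rAct, lAct, hε, mul_assoc])

variable (t) in
/-- `x ⊗ y ↦ ε(x) · y`. -/
def counitFst (ε : T →ₗ[k] R) (hε : ∀ x r, ε (x * s r) = ε x * r) :
    TensorR s t →ₗ[k] T :=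
  RelTensor.lift ((LinearMap.mul k T).flip.compl₁₂
      (t.toLinearMap ∘ₗ (opLinearEquiv k).toLinearMap ∘ₗ ε) LinearMap.id)
    (by intros; simp [rAct, lAct, hε, mul_assoc])

end TensorR

/-- `(T, s, t, Δ, ε)` is a right bialgebroid over `R`: `s` is the source (an algebra
homomorphism), `t` the target (an algebra anti-homomorphism), the `R`-bimodule structure on `T`
is `r · x · r' = x t(r) s(r')`, and `(T, Δ, ε)` is an `R`-coring compatible with the product. -/
structure IsRightBialgebroid (s : R →ₐ[k] T) (t : Rᵐᵒᵖ →ₐ[k] T)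
    (Δ : T →ₗ[k] TensorR s t) (ε : T →ₗ[k] R) : Prop where
  comm : ∀ r r', s r * t (op r') = t (op r') * s r
  comul_left : ∀ x r, Δ (x * t (op r)) = TensorR.left comm r (Δ x)
  comul_right : ∀ x r, Δ (x * s r) = TensorR.right s comm r (Δ x)
  counit_left : ∀ x r, ε (x * t (op r)) = r * ε x
  counit_right : ∀ x r, ε (x * s r) = ε x * r
  coassoc : ∀ x, TensorR.mapFst s comm Δ comul_right (Δ x) =
    TensorR.mapSnd s comm Δ comul_left (Δ x)
  /-- `ε(x₁) · x₂ = x` -/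
  counit_comul : ∀ x, TensorR.counitFst t ε counit_right (Δ x) = x
  /-- `x₁ · ε(x₂) = x` -/
  comul_counit : ∀ x, TensorR.counitSnd s ε counit_left (Δ x) = x
  counit_one : ε 1 = 1
  comul_one : Δ 1 = RelTensor.tmul _ _ 1 1
  /-- `s(r) x₁ ⊗ x₂ = x₁ ⊗ t(r) x₂` -/
  takeuchi : ∀ r x, TensorR.mulFst s t (s r) (Δ x) = TensorR.mulSnd s t (t (op r)) (Δ x)
  /-- `Δ(xy) = x₁ y₁ ⊗ x₂ y₂`, for all representatives of `Δ(x)` and `Δ(y)` in `T ⊗[k] T` -/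
  comul_mul : ∀ (x y : T) (X Y : T ⊗[k] T), RelTensor.mk _ _ X = Δ x → RelTensor.mk _ _ Y = Δ y →
    Δ (x * y) = RelTensor.mk _ _ (X * Y)
  counit_mul_source : ∀ x y, ε (x * y) = ε (s (ε x) * y)
  counit_mul_target : ∀ x y, ε (x * y) = ε (t (op (ε x)) * y)

/-- `(A, η, δ)` is a right comodule algebra over the right bialgebroid `(T, s, t, Δ, ε)`. -/
structure IsRightComoduleAlgebra {s : R →ₐ[k] T} {t : Rᵐᵒᵖ →ₐ[k] T}
    {Δ : T →ₗ[k] TensorR s t} {ε : T →ₗ[k] R} (hT : IsRightBialgebroid s t Δ ε)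
    (η : R →ₐ[k] A) (δ : A →ₗ[k] TensorR η t) : Prop where
  right_linear : ∀ a r, δ (a * η r) = TensorR.right η hT.comm r (δ a)
  /-- `a₀ · ε(a₁) = a` -/
  counit : ∀ a, TensorR.counitSnd η ε hT.counit_left (δ a) = a
  coassoc : ∀ a, TensorR.mapFst η hT.comm δ right_linear (δ a) =
    TensorR.mapSnd η hT.comm Δ hT.comul_left (δ a)
  map_one : δ 1 = RelTensor.tmul _ _ 1 1
  /-- `r a₀ ⊗ a₁ = a₀ ⊗ t(r) a₁` -/
  takeuchi : ∀ r a, TensorR.mulFst η t (η r) (δ a) = TensorR.mulSnd η t (t (op r)) (δ a)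
  /-- `δ(ab) = a₀ b₀ ⊗ a₁ b₁`, for all representatives of `δ(a)` and `δ(b)` in `A ⊗[k] T` -/
  map_mul : ∀ (a b : A) (X Y : A ⊗[k] T), RelTensor.mk _ _ X = δ a → RelTensor.mk _ _ Y = δ b →
    δ (a * b) = RelTensor.mk _ _ (X * Y)

end Bialgebroid

/-! ### The tensor square of an algebra extension, and depth two -/

section Extension

variable {k A : Type*} [CommRing k] [Ring A] [Algebra k A]

/-- `A ⊗_B A`. -/
abbrev TensorSq (B : Subalgebra k A) : Type _ :=
  RelTensor (fun b : B => LinearMap.mulRight k (b : A)) (fun b : B => LinearMap.mulLeft k (b : A))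

namespace TensorSq

variable (B : Subalgebra k A)

/-- The element `x ⊗ y` of `A ⊗_B A`. -/
abbrev tmul (x y : A) : TensorSq B := RelTensor.tmul _ _ x y

/-- The left `A`-action `a · (x ⊗ y) = (a x) ⊗ y`. -/
def lmul (a : A) : Module.End k (TensorSq B) :=
  RelTensor.map (LinearMap.mulLeft k a) LinearMap.id
    (by intros; simp [mul_assoc]) (by intros; rfl)

/-- The right `A`-action `(x ⊗ y) · a = x ⊗ (y a)`. -/
def rmul (a : A) : Module.End k (TensorSq B) :=
  RelTensor.map LinearMap.id (LinearMap.mulRight k a)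
    (by intros; rfl) (by intros; simp [mul_assoc])

@[simp] theorem lmul_tmul (a x y : A) : lmul B a (tmul B x y) = tmul B (a * x) y :=
  RelTensor.map_tmul _ _ _ _ x y

@[simp] theorem rmul_tmul (a x y : A) : rmul B a (tmul B x y) = tmul B x (y * a) :=
  RelTensor.map_tmul _ _ _ _ x y

theorem lmul_lmul (a b : A) (z : TensorSq B) : lmul B a (lmul B b z) = lmul B (a * b) z := by
  have : lmul B a ∘ₗ lmul B b = lmul B (a * b) :=
    RelTensor.hom_ext fun x y => by simp [mul_assoc]
  exact LinearMap.congr_fun this z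

theorem rmul_rmul (a b : A) (z : TensorSq B) : rmul B a (rmul B b z) = rmul B (b * a) z := by
  have : rmul B a ∘ₗ rmul B b = rmul B (b * a) :=
    RelTensor.hom_ext fun x y => by simp [mul_assoc]
  exact LinearMap.congr_fun this z

theorem lmul_rmul (a b : A) (z : TensorSq B) :
    lmul B a (rmul B b z) = rmul B b (lmul B a z) := by
  have : lmul B a ∘ₗ rmul B b = rmul B b ∘ₗ lmul B a :=
    RelTensor.hom_ext fun x y => by simp
  exact LinearMap.congr_fun this z

theorem lmul_one (z : TensorSq B) : lmul B 1 z = z := by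
  have : lmul B 1 = LinearMap.id := RelTensor.hom_ext fun x y => by simp
  exact LinearMap.congr_fun this z

theorem rmul_one (z : TensorSq B) : rmul B 1 z = z := by
  have : rmul B 1 = LinearMap.id := RelTensor.hom_ext fun x y => by simp
  exact LinearMap.congr_fun this z

theorem lmul_add (a b : A) (z : TensorSq B) : lmul B (a + b) z = lmul B a z + lmul B b z := by
  have : lmul B (a + b) = lmul B a + lmul B b :=
    RelTensor.hom_ext fun x y => by simp [add_mul, RelTensor.add_tmul]
  exact LinearMap.congr_fun this z

theorem rmul_add (a b : A) (z : TensorSq B) : rmul B (a + b) z = rmul B a z + rmul B b z := by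
  have : rmul B (a + b) = rmul B a + rmul B b :=
    RelTensor.hom_ext fun x y => by simp [mul_add, RelTensor.tmul_add]
  exact LinearMap.congr_fun this z

theorem lmul_smul (c : k) (a : A) (z : TensorSq B) : lmul B (c • a) z = c • lmul B a z := by
  have : lmul B (c • a) = c • lmul B a :=
    RelTensor.hom_ext fun x y => by simp [RelTensor.smul_tmul]
  exact LinearMap.congr_fun this z

theorem rmul_smul (c : k) (a : A) (z : TensorSq B) : rmul B (c • a) z = c • rmul B a z := by
  have : rmul B (c • a) = c • rmul B a :=
    RelTensor.hom_ext fun x y => by simp [RelTensor.tmul_smul]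
  exact LinearMap.congr_fun this z

/-- The `B`-central elements of `A ⊗_B A`. -/
def central : Submodule k (TensorSq B) where
  carrier := {z | ∀ b ∈ B, lmul B b z = rmul B b z}
  zero_mem' b _ := by simp
  add_mem' hx hy b hb := by simp [hx b hb, hy b hb]
  smul_mem' c x hx b hb := by simp [hx b hb]

/-- The multiplication `x ⊗ y ↦ x y`. -/
def mult : TensorSq B →ₗ[k] A :=
  RelTensor.lift (LinearMap.mul k A) (by intros; simp [mul_assoc])

@[simp] theorem mult_tmul (x y : A) : mult B (tmul B x y) = x * y := by simp [mult]

theorem mult_lmul (a : A) (z : TensorSq B) : mult B (lmul B a z) = a * mult B z := by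
  have : mult B ∘ₗ lmul B a = LinearMap.mulLeft k a ∘ₗ mult B :=
    RelTensor.hom_ext fun x y => by simp [mul_assoc]
  exact LinearMap.congr_fun this z

theorem mult_rmul (a : A) (z : TensorSq B) : mult B (rmul B a z) = mult B z * a := by
  have : mult B ∘ₗ rmul B a = LinearMap.mulRight k a ∘ₗ mult B :=
    RelTensor.hom_ext fun x y => by simp [mul_assoc]
  exact LinearMap.congr_fun this z

variable {B}

/-- For a `B`-central element `t`, the map `x ⊗ y ↦ x · t · y` on `A ⊗_B A`. -/
def sandwich (t : TensorSq B) (ht : t ∈ central B) : TensorSq B →ₗ[k] TensorSq B :=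
  RelTensor.lift (LinearMap.mk₂ k (fun x y => lmul B x (rmul B y t))
    (fun x x' y => lmul_add B _ _ _) (fun c x y => lmul_smul B _ _ _)
    (fun x y y' => by simp [rmul_add]) (fun c x y => by simp [rmul_smul])) (by
      intro b x y
      have h := ht b b.2
      simp only [LinearMap.mk₂_apply, LinearMap.mulRight_apply, LinearMap.mulLeft_apply]
      rw [← rmul_rmul, ← h, ← lmul_lmul, lmul_rmul])

@[simp] theorem sandwich_tmul (t : TensorSq B) (ht : t ∈ central B) (x y : A) :
    sandwich t ht (tmul B x y) = lmul B x (rmul B y t) := by simp [sandwich]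

theorem sandwich_lmul (t : TensorSq B) (ht : t ∈ central B) (a : A) (z : TensorSq B) :
    sandwich t ht (lmul B a z) = lmul B a (sandwich t ht z) := by
  have : sandwich t ht ∘ₗ lmul B a = lmul B a ∘ₗ sandwich t ht :=
    RelTensor.hom_ext fun x y => by simp [lmul_lmul]
  exact LinearMap.congr_fun this z

theorem sandwich_rmul (t : TensorSq B) (ht : t ∈ central B) (a : A) (z : TensorSq B) :
    sandwich t ht (rmul B a z) = rmul B a (sandwich t ht z) := by
  have : sandwich t ht ∘ₗ rmul B a = rmul B a ∘ₗ sandwich t ht :=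
    RelTensor.hom_ext fun x y => by simp [← lmul_rmul, rmul_rmul]
  exact LinearMap.congr_fun this z

theorem sandwich_mem (t u : TensorSq B) (ht : t ∈ central B) (hu : u ∈ central B) :
    sandwich t ht u ∈ central B := fun b hb => by
  rw [← sandwich_lmul, ← sandwich_rmul, hu b hb]

theorem sandwich_sandwich (t u : TensorSq B) (ht : t ∈ central B) (hu : u ∈ central B)
    (z : TensorSq B) : sandwich t ht (sandwich u hu z) =
      sandwich (sandwich t ht u) (sandwich_mem t u ht hu) z := by
  have : sandwich t ht ∘ₗ sandwich u hu =
      sandwich (sandwich t ht u) (sandwich_mem t u ht hu) :=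
    RelTensor.hom_ext fun x y => by simp [sandwich_lmul, sandwich_rmul]
  exact LinearMap.congr_fun this z

theorem sandwich_add (t u : TensorSq B) (ht : t ∈ central B) (hu : u ∈ central B)
    (z : TensorSq B) : sandwich (t + u) ((central B).add_mem ht hu) z =
      sandwich t ht z + sandwich u hu z := by
  have : sandwich (t + u) ((central B).add_mem ht hu) = sandwich t ht + sandwich u hu :=
    RelTensor.hom_ext fun x y => by simp
  exact LinearMap.congr_fun this z

theorem sandwich_smul (c : k) (t : TensorSq B) (ht : t ∈ central B) (z : TensorSq B) :
    sandwich (c • t) ((central B).smul_mem c ht) z = c • sandwich t ht z := by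
  have : sandwich (c • t) ((central B).smul_mem c ht) = c • sandwich t ht :=
    RelTensor.hom_ext fun x y => by simp
  exact LinearMap.congr_fun this z

theorem sandwich_one (h : tmul B 1 1 ∈ central B) (z : TensorSq B) :
    sandwich (tmul B 1 1) h z = z := by
  have : sandwich (tmul B 1 1) h = LinearMap.id := RelTensor.hom_ext fun x y => by simp
  exact LinearMap.congr_fun this z

theorem one_mem : tmul B 1 1 ∈ central B := fun b hb => by
  have := RelTensor.tmul_balanced (fun b : B => LinearMap.mulRight k (b : A))
    (fun b : B => LinearMap.mulLeft k (b : A)) ⟨b, hb⟩ 1 1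
  simpa using this

end TensorSq

/-- `T = (A ⊗_B A)^B`, the `B`-central elements of `A ⊗_B A`. -/
def CentralSq (B : Subalgebra k A) : Type _ := TensorSq.central B

namespace CentralSq

open TensorSq

variable (B : Subalgebra k A)

instance : AddCommGroup (CentralSq B) := inferInstanceAs (AddCommGroup (central B))

instance instModule : Module k (CentralSq B) := inferInstanceAs (Module k (central B))

/-- The inclusion of `T` in `A ⊗_B A`. -/
def val : CentralSq B →ₗ[k] TensorSq B := (central B).subtype

variable {B} in
theorem val_mem (t : CentralSq B) : val B t ∈ central B := t.2

variable {B} in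
/-- A `B`-central element of `A ⊗_B A`, as an element of `T`. -/
def ofMem (z : TensorSq B) (hz : z ∈ central B) : CentralSq B := ⟨z, hz⟩

@[simp] theorem val_ofMem (z : TensorSq B) (hz : z ∈ central B) : val B (ofMem z hz) = z := rfl

theorem val_injective : Function.Injective (val B) := (central B).injective_subtype

/-- The product `t u = u¹ t¹ ⊗ t² u²`. -/
instance : Mul (CentralSq B) :=
  ⟨fun t u => ofMem (sandwich (val B t) t.val_mem (val B u)) (sandwich_mem _ _ _ u.val_mem)⟩

/-- The unit `1 ⊗ 1`. -/
instance : One (CentralSq B) := ⟨ofMem (tmul B 1 1) one_mem⟩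

theorem val_mul (t u : CentralSq B) :
    val B (t * u) = sandwich (val B t) t.val_mem (val B u) := rfl

theorem val_one : val B 1 = tmul B 1 1 := rfl

instance : Ring (CentralSq B) where
  mul_assoc t u v := val_injective B (sandwich_sandwich _ _ t.val_mem u.val_mem _).symm
  one_mul t := val_injective B (sandwich_one one_mem _)
  mul_one t := val_injective B (by rw [val_mul, val_one, sandwich_tmul, rmul_one, lmul_one])
  left_distrib t u v := val_injective B (by simp only [val_mul, map_add])
  right_distrib t u v := val_injective B (sandwich_add _ _ t.val_mem u.val_mem _)
  zero_mul t := val_injective B (by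
    have := sandwich_smul 0 0 ((central B).zero_mem) (val B t)
    simp only [zero_smul] at this
    exact this)
  mul_zero t := val_injective B (by simp only [val_mul, map_zero])
  neg_add_cancel := neg_add_cancel
  zsmul := fun n t => n • t
  zsmul_zero' := SubNegMonoid.zsmul_zero'
  zsmul_succ' := SubNegMonoid.zsmul_succ'
  zsmul_neg' := SubNegMonoid.zsmul_neg'
  nsmul := fun n t => n • t
  nsmul_zero := AddMonoid.nsmul_zero
  nsmul_succ := AddMonoid.nsmul_succ
  sub_eq_add_neg := sub_eq_add_neg

instance : Algebra k (CentralSq B) :=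
  Algebra.ofModule
    (fun c t u => val_injective B (sandwich_smul c _ t.val_mem _))
    (fun c t u => val_injective B (by simp only [val_mul, map_smul]))

/-- The centralizer `R = C_A(B)`. -/
abbrev Cent : Subalgebra k A := Subalgebra.centralizer k (B : Set A)

variable {B}

theorem cent_comm (r : Cent B) {b : A} (hb : b ∈ B) : b * r = r * b :=
  Subalgebra.mem_centralizer_iff k |>.1 r.2 b hb

/-- For `r, r' ∈ R`, the element `r ⊗ r'` of `A ⊗_B A` is in `T`. -/
theorem tmul_mem (r r' : Cent B) : tmul B (r : A) r' ∈ central B := fun b hb => by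
  have h := RelTensor.tmul_balanced (fun b : B => LinearMap.mulRight k (b : A))
    (fun b : B => LinearMap.mulLeft k (b : A)) ⟨b, hb⟩ r r'
  simp only [LinearMap.mulRight_apply, LinearMap.mulLeft_apply] at h
  rw [lmul_tmul, rmul_tmul, cent_comm r hb, ← cent_comm r' hb]
  exact h

variable (B)

/-- The source map `s(r) = 1 ⊗ r`. -/
def source : Cent B →ₐ[k] CentralSq B where
  toFun r := ofMem (tmul B 1 r) (tmul_mem 1 r)
  map_one' := rfl
  map_mul' r r' := val_injective B (by simp [val_mul])
  map_zero' := val_injective B (by simp)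
  map_add' r r' := val_injective B (RelTensor.tmul_add _ _ _ _ _)
  commutes' c := val_injective B (by
    rw [Algebra.algebraMap_eq_smul_one, Algebra.algebraMap_eq_smul_one, map_smul, val_one]
    exact RelTensor.tmul_smul _ _ _ _ _)

/-- The target map `t(r) = r ⊗ 1`, an algebra anti-homomorphism. -/
def target : (Cent B)ᵐᵒᵖ →ₐ[k] CentralSq B where
  toFun r := ofMem (tmul B r.unop 1) (tmul_mem r.unop 1)
  map_one' := rfl
  map_mul' r r' := val_injective B (by simp [val_mul])
  map_zero' := val_injective B (by simp)
  map_add' r r' := val_injective B (RelTensor.add_tmul _ _ _ _ _)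
  commutes' c := val_injective B (by
    rw [Algebra.algebraMap_eq_smul_one, Algebra.algebraMap_eq_smul_one, map_smul, val_one]
    exact RelTensor.smul_tmul _ _ _ _ _)

/-- The counit `ε(t) = t¹ t²`. -/
def counit : CentralSq B →ₗ[k] Cent B :=
  LinearMap.codRestrict (Subalgebra.toSubmodule (Cent B)) (mult B ∘ₗ val B) (fun t => by
    refine (Subalgebra.mem_centralizer_iff k).2 fun b hb => ?_
    have h : lmul B b (val B t) = rmul B b (val B t) := t.val_mem b hb
    simp only [LinearMap.comp_apply]
    rw [← mult_lmul, h, mult_rmul])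

end CentralSq

open TensorSq CentralSq

/-- `A | B` is right depth two: as an `A`-`B`-bimodule, `A ⊗_B A` is isomorphic to a direct summand
of a direct sum `A^(I)` of copies of `A`. -/
def IsRightD2 {k : Type u} {A : Type v} [CommRing k] [Ring A] [Algebra k A]
    (B : Subalgebra k A) : Prop :=
  ∃ (I : Type w) (g : TensorSq B →ₗ[k] (I →₀ A)) (f : (I →₀ A) →ₗ[k] TensorSq B),
    (∀ a z, g (lmul B a z) = Finsupp.mapRange.linearMap (LinearMap.mulLeft k a) (g z)) ∧
    (∀ b ∈ B, ∀ z, g (rmul B b z) = Finsupp.mapRange.linearMap (LinearMap.mulRight k b) (g z)) ∧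
    (∀ a c, f (Finsupp.mapRange.linearMap (LinearMap.mulLeft k a) c) = lmul B a (f c)) ∧
    (∀ b ∈ B, ∀ c, f (Finsupp.mapRange.linearMap (LinearMap.mulRight k b) c) = rmul B b (f c)) ∧
    ∀ z, f (g z) = z

/-- A right D2 quasibase: `B`-bimodule endomorphisms `γ i` of `A` and elements `u i ∈ T` with
`γ i a = 0` for almost all `i`, and `x ⊗ y = ∑ i, x γ_i(y) u_i`. -/
structure RightD2Quasibase (B : Subalgebra k A) (I : Type*) where
  γ : I → A →ₗ[k] A
  map_left : ∀ i, ∀ b ∈ B, ∀ a, γ i (b * a) = b * γ i a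
  map_right : ∀ i, ∀ b ∈ B, ∀ a, γ i (a * b) = γ i a * b
  u : I → CentralSq B
  finite : ∀ a, {i | γ i a ≠ 0}.Finite
  sum_eq : ∀ x y, tmul B x y = ∑ᶠ i, lmul B (x * γ i y) (val B (u i))

namespace RightD2Quasibase

variable {B : Subalgebra k A} {I : Type*} (Q : RightD2Quasibase B I)

/-- `x ⊗ y ↦ x ⊗ γ_i(y)` on `A ⊗_B A`. -/
def idTensor (i : I) : TensorSq B →ₗ[k] TensorSq B :=
  RelTensor.map LinearMap.id (Q.γ i) (by intros; rfl) (by intro b a; exact Q.map_left i b b.2 a)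

@[simp] theorem idTensor_tmul (i : I) (x y : A) :
    Q.idTensor i (tmul B x y) = tmul B x (Q.γ i y) :=
  RelTensor.map_tmul _ _ _ _ x y

theorem idTensor_lmul (i : I) (a : A) (z : TensorSq B) :
    Q.idTensor i (lmul B a z) = lmul B a (Q.idTensor i z) := by
  have : Q.idTensor i ∘ₗ lmul B a = lmul B a ∘ₗ Q.idTensor i :=
    RelTensor.hom_ext fun x y => by simp
  exact LinearMap.congr_fun this z

theorem idTensor_rmul (i : I) {b : A} (hb : b ∈ B) (z : TensorSq B) :
    Q.idTensor i (rmul B b z) = rmul B b (Q.idTensor i z) := by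
  have : Q.idTensor i ∘ₗ rmul B b = rmul B b ∘ₗ Q.idTensor i :=
    RelTensor.hom_ext fun x y => by simp [Q.map_right i b hb]
  exact LinearMap.congr_fun this z

theorem idTensor_finite (z : TensorSq B) : {i | Q.idTensor i z ≠ 0}.Finite := by
  induction z using RelTensor.induction with
  | h0 => simp
  | ht x y =>
    refine (Q.finite y).subset fun i hi h0 => hi ?_
    simp [h0]
  | ha x y hx hy =>
    refine (hx.union hy).subset fun i hi => ?_
    by_contra hc
    simp only [Set.mem_union, Set.mem_ofPred_eq, not_or, not_not] at hc
    exact hi (by simp [hc.1, hc.2])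

/-- `t ↦ t¹ ⊗ γ_i(t²)` on `T`. -/
def idTensorT (i : I) : CentralSq B →ₗ[k] CentralSq B :=
  LinearMap.codRestrict (central B) (Q.idTensor i ∘ₗ val B) (by
    intro t b hb
    have h : lmul B b (val B t) = rmul B b (val B t) := t.val_mem b hb
    simp only [LinearMap.comp_apply]
    rw [← idTensor_lmul, h, idTensor_rmul Q i hb])

theorem val_idTensorT (i : I) (t : CentralSq B) :
    val B (Q.idTensorT i t) = Q.idTensor i (val B t) := rfl

theorem idTensorT_finite (t : CentralSq B) : {i | Q.idTensorT i t ≠ 0}.Finite := by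
  refine (Q.idTensor_finite (val B t)).subset fun i hi h0 => hi ?_
  exact val_injective B (by simpa [val_idTensorT] using h0)

/-- The coproduct `Δ(t) = ∑ i, (t¹ ⊗ γ_i(t²)) ⊗_R u_i`, a finite sum for each `t`. -/
noncomputable def comul : CentralSq B →ₗ[k] TensorR (source B) (target B) where
  toFun t := ∑ᶠ i, RelTensor.tmul _ _ (Q.idTensorT i t) (Q.u i)
  map_add' t t' := by
    rw [← finsum_add_distrib]
    · simp [RelTensor.add_tmul]
    · refine (Q.idTensorT_finite t).subset fun i hi h0 => hi ?_
      simp [h0]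
    · refine (Q.idTensorT_finite t').subset fun i hi h0 => hi ?_
      simp [h0]
  map_smul' c t := by
    rw [RingHom.id_apply, smul_finsum' c]
    · simp [RelTensor.smul_tmul]
    · refine (Q.idTensorT_finite t).subset fun i hi h0 => hi ?_
      simp [h0]

/-- The coaction `δ(a) = ∑ i, γ_i(a) ⊗_R u_i`, a finite sum for each `a`. -/
noncomputable def coaction : A →ₗ[k] TensorR (Cent B).val (target B) where
  toFun a := ∑ᶠ i, RelTensor.tmul _ _ (Q.γ i a) (Q.u i)
  map_add' t t' := by
    rw [← finsum_add_distrib]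
    · simp [RelTensor.add_tmul]
    · refine (Q.finite t).subset fun i hi h0 => hi ?_
      simp [h0]
    · refine (Q.finite t').subset fun i hi h0 => hi ?_
      simp [h0]
  map_smul' c t := by
    rw [RingHom.id_apply, smul_finsum' c]
    · simp [RelTensor.smul_tmul]
    · refine (Q.finite t).subset fun i hi h0 => hi ?_
      simp [h0]

end RightD2Quasibase

end Extension

/-! ### Galois extensions -/

section Galois

variable {k A : Type*} [CommRing k] [Ring A] [Algebra k A]

section ForBialgebroids

variable {R T : Type*} [Ring R] [Algebra k R] [Ring T] [Algebra k T]
  {s : R →ₐ[k] T} {t : Rᵐᵒᵖ →ₐ[k] T} {Δ : T →ₗ[k] TensorR s t} {ε : T →ₗ[k] R}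
  {hT : IsRightBialgebroid s t Δ ε} {η : R →ₐ[k] A} {δ : A →ₗ[k] TensorR η t}

theorem TensorR.mulFst_mk (η : R →ₐ[k] A) (t : Rᵐᵒᵖ →ₐ[k] T) (a : A) (X : A ⊗[k] T) :
    TensorR.mulFst η t a (RelTensor.mk _ _ X) = RelTensor.mk _ _ ((a ⊗ₜ[k] (1 : T)) * X) := by
  induction X with
  | zero => simp
  | tmul x y =>
    rw [Algebra.TensorProduct.tmul_mul_tmul, one_mul]
    exact RelTensor.map_tmul _ _ _ _ x y
  | add x y hx hy => simp only [map_add, mul_add, hx, hy]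

/-- `δ(b y) = b δ(y)` for a coinvariant `b`. -/
theorem IsRightComoduleAlgebra.map_coinvariant_mul (hA : IsRightComoduleAlgebra hT η δ)
    {b : A} (hb : δ b = RelTensor.tmul _ _ b 1) (y : A) :
    δ (b * y) = TensorR.mulFst η t b (δ y) := by
  obtain ⟨Y, hY⟩ := RelTensor.mk_surjective _ _ (δ y)
  rw [hA.map_mul b y (b ⊗ₜ 1) Y hb.symm hY, ← hY, TensorR.mulFst_mk]

/-- `a z` is bilinear in `a ∈ A` and `z ∈ A ⊗_R T`. -/
def TensorR.mulFstBilin (η : R →ₐ[k] A) (t : Rᵐᵒᵖ →ₐ[k] T) :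
    A →ₗ[k] TensorR η t →ₗ[k] TensorR η t where
  toFun a := TensorR.mulFst η t a
  map_add' a b := RelTensor.hom_ext fun x y => by
    simp [add_mul, RelTensor.add_tmul]
  map_smul' c a := RelTensor.hom_ext fun x y => by
    simp [RelTensor.smul_tmul]

/-- The Galois map `A ⊗_B A → A ⊗_R T`, `x ⊗ y ↦ x y₀ ⊗ y₁`, for a subalgebra `B` consisting of
coinvariants. -/
def IsRightComoduleAlgebra.galoisMap (hA : IsRightComoduleAlgebra hT η δ) (B : Subalgebra k A)
    (hB : ∀ b ∈ B, δ b = RelTensor.tmul _ _ b 1) : TensorSq B →ₗ[k] TensorR η t :=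
  RelTensor.lift ((TensorR.mulFstBilin η t).compl₁₂ LinearMap.id δ) (by
    intro b x y
    have h : TensorR.mulFst η t (x * b) = TensorR.mulFst η t x ∘ₗ TensorR.mulFst η t b :=
      RelTensor.hom_ext fun y z => by simp [mul_assoc]
    simpa [TensorR.mulFstBilin, hA.map_coinvariant_mul (hB b b.2)] using
      LinearMap.congr_fun h (δ y))

/-- `A | B` is a right `T`-Galois extension: `B` is the set of `T`-coinvariants `{a | δ(a) = a ⊗ 1}`
and the Galois map `A ⊗_B A → A ⊗_R T` is bijective. -/
def IsRightComoduleAlgebra.IsGalois (hA : IsRightComoduleAlgebra hT η δ)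
    (B : Subalgebra k A) : Prop :=
  ∃ hB : ∀ a, a ∈ B ↔ δ a = RelTensor.tmul _ _ a 1,
    Function.Bijective (hA.galoisMap B fun b hb => (hB b).1 hb)

end ForBialgebroids

section ForHopfAlgebras

variable {H : Type*} [Ring H] [HopfAlgebra k H]

/-- `δ : A → A ⊗ H` is a right `H`-comodule algebra structure on `A`. -/
structure IsHopfComoduleAlgebra (δ : A →ₐ[k] A ⊗[k] H) : Prop where
  coassoc : ∀ a, TensorProduct.assoc k A H H (δ.toLinearMap.rTensor H (δ a)) =
    (Coalgebra.comul (R := k) (A := H)).lTensor A (δ a)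
  counit : ∀ a, TensorProduct.rid k A ((Coalgebra.counit (R := k) (A := H)).lTensor A (δ a)) = a

/-- `A | B` is a right `H`-extension with coaction `δ`: `A` is a right `H`-comodule algebra and
`B` is its subalgebra of coinvariants. -/
structure IsHopfExtension (δ : A →ₐ[k] A ⊗[k] H) (B : Subalgebra k A) : Prop where
  comoduleAlgebra : IsHopfComoduleAlgebra δ
  mem_iff : ∀ a, a ∈ B ↔ δ a = a ⊗ₜ[k] (1 : H)

/-- The Galois map `β : A ⊗_B A → A ⊗ H`, `x ⊗ y ↦ x y₀ ⊗ y₁`. -/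
noncomputable def IsHopfExtension.galoisMap {δ : A →ₐ[k] A ⊗[k] H} {B : Subalgebra k A}
    (h : IsHopfExtension δ B) : TensorSq B →ₗ[k] A ⊗[k] H :=
  RelTensor.lift ((LinearMap.mul k (A ⊗[k] H)).compl₁₂
      (Algebra.TensorProduct.includeLeft (R := k) (S := k) (A := A) (B := H)).toLinearMap
      δ.toLinearMap)
    (by
      intro b x y
      simp [(h.mem_iff b).1 b.2, ← mul_assoc])

/-- The Galois map is a split monomorphism of `A`-`B`-bimodules, where
`a · (x ⊗ h) · b = a x b ⊗ h` on `A ⊗ H`. -/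
def IsHopfExtension.IsSplitMono {δ : A →ₐ[k] A ⊗[k] H} {B : Subalgebra k A}
    (h : IsHopfExtension δ B) : Prop :=
  ∃ σ : A ⊗[k] H →ₗ[k] TensorSq B,
    (∀ a z, σ ((LinearMap.mulLeft k a).rTensor H z) = TensorSq.lmul B a (σ z)) ∧
    (∀ b ∈ B, ∀ z, σ ((LinearMap.mulRight k b).rTensor H z) = TensorSq.rmul B b (σ z)) ∧
    ∀ z, σ (h.galoisMap z) = z

end ForHopfAlgebras

end Galois

/-!
Since `H` is projective, `A ⊗ H` is a direct summand of `A^(H)` as an `A`-`B`-bimodule, and the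
splitting of the Galois map makes `A ⊗_B A` a direct summand of `A ⊗ H`. This is right depth two
(`IsHopfExtension.IsSplitMono.isRightD2`). The coordinates of `1 ⊗ a` in `A^(I)` and the images of
the basis vectors form a quasibase (`IsRightD2.exists_quasibase`).

The rest holds for every extension with a quasibase `γ_i`, `u_i`. For a right `A`-module `N` and an
`R`-submodule `M` of `N`, the map `M ⊗_R T → N ⊗_B A`, `m ⊗ t ↦ (m t¹) ⊗ t²` is injective
(`RightD2Quasibase.embed_injective`): since `t = ∑ (t¹ γ_i(t²)) u_i` with `t¹ γ_i(t²) ∈ R`, an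
element with image `∑ n ⊗ a` equals `∑_i (∑ n γ_i(a)) ⊗ u_i`. Applied to `A ⊆ A` and `T ⊆ A ⊗_B A`,
and then again to the tensor products obtained, this embeds

* `A ⊗_R T` in `A ⊗_B A` (`embedA`), where `δ_T(a)` becomes `1 ⊗ a`;
* `T ⊗_R T` in `A ⊗_B A ⊗_B A` (`embedT`), where `Δ(t)` becomes `t¹ ⊗ 1 ⊗ t²`;
* the threefold products in tensor powers of `A` over `B` with one more factor (`embedTriple`).

The images of `δ_T(a)` and `Δ(t)` do not involve the quasibase, so neither do `δ_T` and `Δ`, and each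
axiom becomes an obvious identity in a tensor power of `A`: coassociativity, for instance, says
that inserting `1` twice gives `t¹ ⊗ 1 ⊗ 1 ⊗ t²` in either order. The Galois map `x ⊗ y ↦ x δ_T(y)`
is a section of `embedA`, hence its inverse. Finally, `a` is coinvariant under `T` if and only if
`1 ⊗ a = a ⊗ 1` in `A ⊗_B A`, and the Galois map of `H` takes this to `δ(a) = a ⊗ 1`, that is,
`a ∈ B`.
-/

/-! ### Right actions, and the tensor product over the subalgebra -/

section RightAction

variable {k A N : Type*} [CommRing k] [Ring A] [Algebra k A] [AddCommGroup N] [Module k N]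

/-- `ρ` is a `k`-linear right action of the algebra `A` on the `k`-module `N`,
with `n · a = ρ a n`. -/
structure IsRightAction (ρ : A → Module.End k N) : Prop where
  map_one : ∀ n, ρ 1 n = n
  map_mul : ∀ a b n, ρ (a * b) n = ρ b (ρ a n)
  map_add : ∀ a b n, ρ (a + b) n = ρ a n + ρ b n
  map_smul : ∀ (c : k) a n, ρ (c • a) n = c • ρ a n

theorem isRightAction_mulRight : IsRightAction (LinearMap.mulRight k : A → Module.End k A) where
  map_one n := by simp
  map_mul a b n := by simp [mul_assoc]
  map_add a b n := by simp [mul_add]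
  map_smul c a n := by simp

/-- `N ⊗_B A` for a right `A`-module `N`. For `N = A` it is `A ⊗_B A`. -/
abbrev TensorB (B : Subalgebra k A) (ρ : A → Module.End k N) : Type _ :=
  RelTensor (fun b : B => ρ (b : A)) (fun b : B => LinearMap.mulLeft k (b : A))

namespace TensorB

variable (B : Subalgebra k A) (ρ : A → Module.End k N)

/-- The element `n ⊗ a` of `N ⊗_B A`. -/
abbrev tmul (n : N) (a : A) : TensorB B ρ := RelTensor.tmul _ _ n a

/-- The right `A`-action `(n ⊗ x) · a = n ⊗ (x a)` on `N ⊗_B A`. -/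
def rmul (a : A) : Module.End k (TensorB B ρ) :=
  RelTensor.map LinearMap.id (LinearMap.mulRight k a)
    (by intros; rfl) (by intros; simp [mul_assoc])

@[simp] theorem rmul_tmul (a : A) (n : N) (x : A) :
    rmul B ρ a (tmul B ρ n x) = tmul B ρ n (x * a) :=
  RelTensor.map_tmul _ _ _ _ n x

theorem isRightAction_rmul : IsRightAction (rmul B ρ) where
  map_one z := by
    have : rmul B ρ 1 = LinearMap.id := RelTensor.hom_ext fun x y => by simp
    exact LinearMap.congr_fun this z
  map_mul a b z := by
    have : rmul B ρ (a * b) = rmul B ρ b ∘ₗ rmul B ρ a :=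
      RelTensor.hom_ext fun x y => by simp [mul_assoc]
    exact LinearMap.congr_fun this z
  map_add a b z := by
    have : rmul B ρ (a + b) = rmul B ρ a + rmul B ρ b :=
      RelTensor.hom_ext fun x y => by simp [mul_add, RelTensor.tmul_add]
    exact LinearMap.congr_fun this z
  map_smul c a z := by
    have : rmul B ρ (c • a) = c • rmul B ρ a :=
      RelTensor.hom_ext fun x y => by simp [RelTensor.tmul_smul]
    exact LinearMap.congr_fun this z

variable {B ρ} {N' : Type*} [AddCommGroup N'] [Module k N'] {ρ' : A → Module.End k N'}

/-- `f ⊗ id : N ⊗_B A → N' ⊗_B A` for a right `B`-linear map `f`. -/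
def mapFst (f : N →ₗ[k] N') (hf : ∀ b ∈ B, ∀ n, f (ρ b n) = ρ' b (f n)) :
    TensorB B ρ →ₗ[k] TensorB B ρ' :=
  RelTensor.map f LinearMap.id (fun b n => hf b b.2 n) (by intros; rfl)

@[simp] theorem mapFst_tmul (f : N →ₗ[k] N') (hf : ∀ b ∈ B, ∀ n, f (ρ b n) = ρ' b (f n))
    (n : N) (a : A) : mapFst f hf (tmul B ρ n a) = tmul B ρ' (f n) a :=
  RelTensor.map_tmul _ _ _ _ n a

variable (B) in
/-- `n ⊗ a ↦ (n ⊗ 1) ⊗ a`, as a map `N ⊗_B A → (N ⊗_B A) ⊗_B A`. -/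
def insOne (ρ : A → Module.End k N) : TensorB B ρ →ₗ[k] TensorB B (rmul B ρ) :=
  mapFst ((RelTensor.mkBilin _ _).flip 1) (fun b hb n => by
    have := RelTensor.tmul_balanced (fun b : B => ρ (b : A))
      (fun b : B => LinearMap.mulLeft k (b : A)) ⟨b, hb⟩ n 1
    simpa using this)

@[simp] theorem insOne_tmul (n : N) (a : A) :
    insOne B ρ (tmul B ρ n a) = tmul B (rmul B ρ) (tmul B ρ n 1) a :=
  mapFst_tmul _ _ n a

variable (hρ : IsRightAction ρ)

/-- The right `A`-linear map `A → N`, `a ↦ n · a`. -/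
def orbit (hρ : IsRightAction ρ) (n : N) : A →ₗ[k] N where
  toFun a := ρ a n
  map_add' a b := hρ.map_add a b n
  map_smul' c a := hρ.map_smul c a n

variable (B) in
/-- `x ⊗ y ↦ (n x) ⊗ y`, for `n` in the right `A`-module `N`. -/
def actAt (n : N) : TensorSq B →ₗ[k] TensorB B ρ :=
  RelTensor.map (orbit hρ n) LinearMap.id (fun b a => hρ.map_mul a b n) (by intros; rfl)

theorem actAt_tmul (n : N) (x y : A) :
    actAt B hρ n (TensorSq.tmul B x y) = tmul B ρ (ρ x n) y :=
  RelTensor.map_tmul _ _ _ _ x y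

/-- `n · (x ⊗ y) = (n x) ⊗ y`, for `n` in the right `A`-module `N` and `x ⊗ y` in `A ⊗_B A`. -/
def act : N →ₗ[k] TensorSq B →ₗ[k] TensorB B ρ where
  toFun n := actAt B hρ n
  map_add' n n' := RelTensor.hom_ext fun x y => by
    simp only [LinearMap.add_apply, actAt_tmul, map_add, RelTensor.add_tmul]
  map_smul' c n := RelTensor.hom_ext fun x y => by
    simp only [LinearMap.smul_apply, actAt_tmul, map_smul, RelTensor.smul_tmul, RingHom.id_apply]

@[simp] theorem act_tmul (n : N) (x y : A) :
    act hρ n (TensorSq.tmul B x y) = tmul B ρ (ρ x n) y :=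
  actAt_tmul hρ n x y

theorem act_lmul (n : N) (a : A) (z : TensorSq B) :
    act hρ n (TensorSq.lmul B a z) = act hρ (ρ a n) z := by
  have : act hρ n ∘ₗ TensorSq.lmul B a = act hρ (ρ a n) :=
    RelTensor.hom_ext fun x y => by simp [hρ.map_mul]
  exact LinearMap.congr_fun this z

theorem act_rmul (n : N) (a : A) (z : TensorSq B) :
    act hρ n (TensorSq.rmul B a z) = rmul B ρ a (act hρ n z) := by
  have : act hρ n ∘ₗ TensorSq.rmul B a = rmul B ρ a ∘ₗ act hρ n :=
    RelTensor.hom_ext fun x y => by simp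
  exact LinearMap.congr_fun this z

theorem act_mulRight (n : A) (z : TensorSq B) :
    act isRightAction_mulRight n z = TensorSq.lmul B n z := by
  have : act isRightAction_mulRight n = TensorSq.lmul B n :=
    RelTensor.hom_ext fun x y => by simp
  exact LinearMap.congr_fun this z

theorem mapFst_act (hρ' : IsRightAction ρ') (f : N →ₗ[k] N')
    (hf : ∀ a n, f (ρ a n) = ρ' a (f n)) (n : N) (z : TensorSq B) :
    mapFst f (fun b _ => hf b) (act hρ n z) = act hρ' (f n) z := by
  have : mapFst f (fun b _ => hf b) ∘ₗ act (B := B) hρ n = act hρ' (f n) :=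
    RelTensor.hom_ext fun x y => by simp [hf]
  exact LinearMap.congr_fun this z

/-- For a `B`-central element `q`, the map `n ⊗ y ↦ (n q¹) ⊗ (q² y)` on `N ⊗_B A`. -/
def sandwich (q : TensorSq B) (hq : q ∈ TensorSq.central B) : TensorB B ρ →ₗ[k] TensorB B ρ :=
  RelTensor.lift (LinearMap.mk₂ k (fun n y => rmul B ρ y (act hρ n q))
    (fun n n' y => by simp) (fun c n y => by simp)
    (fun n y y' => (isRightAction_rmul B ρ).map_add _ _ _)
    (fun c n y => (isRightAction_rmul B ρ).map_smul _ _ _)) (by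
      intro b n y
      have h := hq b b.2
      simp only [LinearMap.mk₂_apply, LinearMap.mulLeft_apply]
      rw [(isRightAction_rmul B ρ).map_mul, ← act_lmul, h, act_rmul])

@[simp] theorem sandwich_tmul (q : TensorSq B) (hq : q ∈ TensorSq.central B) (n : N) (y : A) :
    sandwich hρ q hq (tmul B ρ n y) = rmul B ρ y (act hρ n q) := by simp [sandwich]

theorem act_sandwich (q : TensorSq B) (hq : q ∈ TensorSq.central B) (n : N) (z : TensorSq B) :
    act hρ n (TensorSq.sandwich q hq z) = sandwich hρ q hq (act hρ n z) := by
  have : act hρ n ∘ₗ TensorSq.sandwich q hq = sandwich hρ q hq ∘ₗ act hρ n :=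
    RelTensor.hom_ext fun x y => by simp [act_lmul, act_rmul]
  exact LinearMap.congr_fun this z

end TensorB

end RightAction

/-! ### Embedding `M ⊗_R T` into `N ⊗_B A` -/

section Embedding

open TensorSq CentralSq

variable {k A : Type*} [CommRing k] [Ring A] [Algebra k A]

namespace CentralSq

variable (B : Subalgebra k A)

theorem val_source (r : Cent B) : val B (source B r) = tmul B 1 (r : A) := rfl

theorem val_target (r : Cent B) : val B (target B (op r)) = tmul B (r : A) 1 := rfl

theorem val_mul_source (t : CentralSq B) (r : Cent B) :
    val B (t * source B r) = rmul B r (val B t) :=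
  (sandwich_tmul (val B t) t.val_mem 1 (r : A)).trans (lmul_one B _)

theorem val_mul_target (t : CentralSq B) (r : Cent B) :
    val B (t * target B (op r)) = lmul B r (val B t) := by
  refine (sandwich_tmul (val B t) t.val_mem (r : A) 1).trans ?_
  rw [rmul_one]

theorem source_mul_target (r r' : Cent B) :
    source B r * target B (op r') = target B (op r') * source B r := by
  refine val_injective B ?_
  rw [val_mul_target, val_mul_source, val_source, val_target, lmul_tmul, rmul_tmul, mul_one,
    one_mul]

theorem coe_counit (t : CentralSq B) : (counit B t : A) = mult B (val B t) := rfl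

end CentralSq

variable {N M : Type*} [AddCommGroup N] [Module k N] [AddCommGroup M] [Module k M]
  {B : Subalgebra k A} {ρ : A → Module.End k N} (hρ : IsRightAction ρ)
  {μ : Cent B → Module.End k M} (j : M →ₗ[k] N) (hj : ∀ r m, j (μ r m) = ρ r (j m))

/-- The map `M ⊗_R T → N ⊗_B A`, `m ⊗ t ↦ j(m) t`, for a map `j : M → N` from an `R`-module to an
`A`-module that is compatible with the right `R`-actions. -/
def embed : RelTensor μ (lAct (target B)) →ₗ[k] TensorB B ρ :=
  RelTensor.lift ((TensorB.act hρ).compl₁₂ j (val B)) (by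
    intro r m t
    simp only [LinearMap.compl₁₂_apply, hj, lAct, LinearMap.mulRight_apply, val_mul_target,
      TensorB.act_lmul])

@[simp] theorem embed_tmul (m : M) (t : CentralSq B) :
    embed hρ j hj (RelTensor.tmul _ _ m t) = TensorB.act hρ (j m) (val B t) := by
  simp [embed]

namespace RightD2Quasibase

variable {I : Type*} (Q : RightD2Quasibase B I)

/-- `n ⊗ x ↦ n γ_i(x)` on `N ⊗_B A`. -/
def coord (i : I) : TensorB B ρ →ₗ[k] N :=
  RelTensor.lift (LinearMap.mk₂ k (fun n x => ρ (Q.γ i x) n) (by simp) (by simp)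
    (fun n x x' => by rw [map_add, hρ.map_add]) (fun c n x => by rw [map_smul, hρ.map_smul])) (by
      intro b n x
      simp only [LinearMap.mk₂_apply, LinearMap.mulLeft_apply]
      rw [Q.map_left i b b.2, hρ.map_mul])

@[simp] theorem coord_tmul (i : I) (n : N) (x : A) :
    Q.coord hρ i (TensorB.tmul B ρ n x) = ρ (Q.γ i x) n := by simp [coord]

theorem coord_act (i : I) (n : N) (z : TensorSq B) :
    Q.coord hρ i (TensorB.act hρ n z) = ρ (mult B (Q.idTensor i z)) n := by
  induction z using RelTensor.induction with
  | h0 => simpa using (hρ.map_smul 0 0 n).symm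
  | ht x y => simp [hρ.map_mul]
  | ha x y hx hy => simp only [map_add, hx, hy, hρ.map_add]

theorem finsum_lmul (z : TensorSq B) :
    ∑ᶠ i, lmul B (mult B (Q.idTensor i z)) (val B (Q.u i)) = z := by
  have hfin (z : TensorSq B) :
      (Function.support fun i => lmul B (mult B (Q.idTensor i z)) (val B (Q.u i))).Finite := by
    refine (Q.idTensor_finite z).subset fun i hi h0 => hi ?_
    simpa [h0] using lmul_smul B 0 0 (val B (Q.u i))
  induction z using RelTensor.induction with
  | h0 =>
    have (i : I) : lmul B 0 (val B (Q.u i)) = 0 := by simpa using lmul_smul B 0 0 (val B (Q.u i))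
    simp [this]
  | ht x y => simpa using (Q.sum_eq x y).symm
  | ha x y hx hy =>
    simp only [map_add, lmul_add]
    rw [finsum_add_distrib (hfin x) (hfin y), hx, hy]

/-- The `u_i` generate `T` over `R`, the coefficients of `t` being the `t¹ γ_i(t²) ∈ R`. -/
theorem finsum_mul_target (t : CentralSq B) :
    ∑ᶠ i, Q.u i * target B (op (counit B (Q.idTensorT i t))) = t := by
  refine val_injective B ?_
  refine (AddMonoidHom.map_finsum_of_injective (val B).toAddMonoidHom (val_injective B) _).trans ?_
  refine (finsum_congr fun i => ?_).trans (Q.finsum_lmul (val B t))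
  exact val_mul_target B _ _

/-- Every element of `M ⊗_R T` is a combination of the `1 ⊗ u_i` with coefficients in `M`, which
are determined by the image in `N ⊗_B A`. -/
theorem exists_eq_finsum (hj' : Function.Injective j) (X : RelTensor μ (lAct (target B))) :
    ∃ c : I → M, c.support.Finite ∧ X = ∑ᶠ i, RelTensor.tmul _ _ (c i) (Q.u i) ∧
      ∀ i, j (c i) = Q.coord hρ i (embed hρ j hj X) := by
  induction X using RelTensor.induction with
  | h0 => exact ⟨0, by simp, by simp, by simp⟩
  | ht m t =>
    have hμ : μ 0 m = 0 := hj' (by simpa [hj] using hρ.map_smul 0 0 (j m))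
    have hfin : {i | counit B (Q.idTensorT i t) ≠ 0}.Finite :=
      (Q.idTensorT_finite t).subset fun i hi h0 => hi (by simp [h0])
    refine ⟨fun i => μ (counit B (Q.idTensorT i t)) m, hfin.subset fun i hi h0 => hi ?_, ?_,
      fun i => ?_⟩
    · simp [h0, hμ]
    · conv_lhs => rw [← Q.finsum_mul_target t]
      refine (map_finsum (RelTensor.mkBilin μ (lAct (target B)) m)
        (hfin.subset fun i hi h0 => hi ?_)).trans (finsum_congr fun i => ?_)
      · simp [h0]
      · exact (RelTensor.tmul_balanced μ (lAct (target B)) _ m (Q.u i)).symm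
    · rw [hj, embed_tmul, coord_act]
      rfl
  | ha X Y hX hY =>
    obtain ⟨c, hc, hX, hcX⟩ := hX
    obtain ⟨d, hd, hY, hdY⟩ := hY
    have hfin {c : I → M} (hc : c.support.Finite) : (Function.support fun i =>
        RelTensor.tmul μ (lAct (target B)) (c i) (Q.u i)).Finite :=
      hc.subset fun i hi h0 => hi (by simp [h0])
    refine ⟨c + d, (hc.union hd).subset (Function.support_add c d), ?_, fun i => ?_⟩
    · simp only [Pi.add_apply, RelTensor.add_tmul]
      rw [finsum_add_distrib (hfin hc) (hfin hd), ← hX, ← hY]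
    · simp only [Pi.add_apply, map_add, hcX, hdY]

/-- A quasibase makes `M ⊗_R T → N ⊗_B A` injective: by `exists_eq_finsum` an element of
`M ⊗_R T` can be recovered from its image. -/
theorem embed_injective {I : Type*} (Q : RightD2Quasibase B I) (hj' : Function.Injective j) :
    Function.Injective (embed hρ j hj) := by
  refine (injective_iff_map_eq_zero _).2 fun X h0 => ?_
  obtain ⟨c, -, hX, hc⟩ := Q.exists_eq_finsum hρ j hj hj' X
  have h (i : I) : c i = 0 := hj' (by rw [hc i, h0, map_zero, map_zero])
  simpa [h] using hX

theorem finsum_act (n : N) (x : A) :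
    ∑ᶠ i, TensorB.act hρ (ρ (Q.γ i x) n) (val B (Q.u i)) = TensorB.tmul B ρ n x := by
  have h : TensorB.tmul B ρ n x = TensorB.act hρ n (tmul B 1 x) := by
    rw [TensorB.act_tmul, hρ.map_one]
  rw [h, Q.sum_eq, map_finsum (TensorB.act hρ n)]
  · simp only [one_mul, TensorB.act_lmul]
  · refine (Q.finite x).subset fun i hi h0 => hi ?_
    simpa [h0] using lmul_smul B 0 0 (val B (Q.u i))

end RightD2Quasibase

end Embedding

/-! ### The structure maps of `T`-comodules under the embedding -/

section StructureMaps

open TensorSq CentralSq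

variable {k A : Type*} [CommRing k] [Ring A] [Algebra k A] {B : Subalgebra k A}

theorem TensorB.insOne_rmul {N : Type*} [AddCommGroup N] [Module k N] {ρ : A → Module.End k N}
    (a : A) (z : TensorB B ρ) :
    insOne B ρ (rmul B ρ a z) = rmul B (rmul B ρ) a (insOne B ρ z) := by
  have : insOne B ρ ∘ₗ rmul B ρ a = rmul B (rmul B ρ) a ∘ₗ insOne B ρ :=
    RelTensor.hom_ext fun x y => by simp
  exact LinearMap.congr_fun this z

variable {N M : Type*} [AddCommGroup N] [Module k N] [Ring M] [Algebra k M]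
  {ρ : A → Module.End k N} (hρ : IsRightAction ρ) (η : Cent B →ₐ[k] M) (j : M →ₗ[k] N)
  (hj : ∀ r m, j (m * η r) = ρ (r : A) (j m))

/-- The map `M ⊗_R T → N ⊗_B A`, `m ⊗ t ↦ j(m) t`, for an algebra `M` over `R`. -/
def embedR : TensorR η (target B) →ₗ[k] TensorB B ρ := embed hρ (μ := rAct η) j hj

@[simp] theorem embedR_tmul (m : M) (t : CentralSq B) :
    embedR hρ η j hj (RelTensor.tmul _ _ m t) = TensorB.act hρ (j m) (val B t) :=
  embed_tmul hρ j hj m t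

variable (B) in
/-- The map `T ⊗_R T → A ⊗_B A ⊗_B A`, `t ⊗ u ↦ t¹ ⊗ t² u¹ ⊗ u²`. -/
def embedT : TensorR (source B) (target B) →ₗ[k]
    TensorB B (TensorB.rmul B (LinearMap.mulRight k)) :=
  embedR (TensorB.isRightAction_rmul B (LinearMap.mulRight k)) (source B) (val B)
    (fun r t => val_mul_source B t r)

@[simp] theorem embedT_tmul (t u : CentralSq B) : embedT B (RelTensor.tmul _ _ t u) =
    TensorB.act (TensorB.isRightAction_rmul B (LinearMap.mulRight k)) (val B t) (val B u) :=
  embedR_tmul _ _ _ _ t u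

@[simp] theorem TensorR.mulSnd_tmul (q t : CentralSq B) (m : M) :
    TensorR.mulSnd η (target B) q (RelTensor.tmul _ _ m t) = RelTensor.tmul _ _ m (q * t) :=
  RelTensor.map_tmul _ _ _ _ m t

theorem embedR_right (r : Cent B) (X : TensorR η (target B)) :
    embedR hρ η j hj (TensorR.right η (source_mul_target B) r X) =
      TensorB.rmul B ρ (r : A) (embedR hρ η j hj X) := by
  have : embedR hρ η j hj ∘ₗ TensorR.right η (source_mul_target B) r =
      TensorB.rmul B ρ (r : A) ∘ₗ embedR hρ η j hj :=
    RelTensor.hom_ext fun m t => by simp [val_mul_source, TensorB.act_rmul]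
  exact LinearMap.congr_fun this X

/-- The map `M ⊗_R T ⊗_R T → N ⊗_B A ⊗_B A`, `m ⊗ t ⊗ u ↦ j(m) t u`: the embedding of
`M' ⊗_R T` into `N' ⊗_B A` for `M' = M ⊗_R T` and `N' = N ⊗_B A`. -/
def embedTriple : TensorR.Triple η (source_mul_target B) →ₗ[k] TensorB B (TensorB.rmul B ρ) :=
  embed (TensorB.isRightAction_rmul B ρ) (embedR hρ η j hj) (embedR_right hρ η j hj)

theorem embedR_mulFst (p : M) (σ : Module.End k N) (hσ : ∀ a n, σ (ρ a n) = ρ a (σ n))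
    (hp : ∀ m, j (p * m) = σ (j m)) (X : TensorR η (target B)) :
    embedR hρ η j hj (TensorR.mulFst η (target B) p X) =
      TensorB.mapFst σ (fun b _ => hσ b) (embedR hρ η j hj X) := by
  have : embedR hρ η j hj ∘ₗ TensorR.mulFst η (target B) p =
      TensorB.mapFst σ (fun b _ => hσ b) ∘ₗ embedR hρ η j hj :=
    RelTensor.hom_ext fun m t => by simp [TensorB.mapFst_act hρ hρ σ hσ, hp]
  exact LinearMap.congr_fun this X

theorem embedR_mulSnd (q : CentralSq B) (X : TensorR η (target B)) :
    embedR hρ η j hj (TensorR.mulSnd η (target B) q X) =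
      TensorB.sandwich hρ (val B q) q.val_mem (embedR hρ η j hj X) := by
  have : embedR hρ η j hj ∘ₗ TensorR.mulSnd η (target B) q =
      TensorB.sandwich hρ (val B q) q.val_mem ∘ₗ embedR hρ η j hj :=
    RelTensor.hom_ext fun m t => by
      simp [← TensorB.act_sandwich, val_mul]
  exact LinearMap.congr_fun this X

theorem TensorR.mk_tmul_mul (p : M) (q : CentralSq B) (Y : M ⊗[k] CentralSq B) :
    RelTensor.mk (rAct η) (lAct (target B)) (p ⊗ₜ q * Y) =
      TensorR.mulSnd η (target B) q (TensorR.mulFst η (target B) p (RelTensor.mk _ _ Y)) := by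
  induction Y with
  | zero => simp
  | tmul m t =>
    rw [Algebra.TensorProduct.tmul_mul_tmul]
    change RelTensor.tmul _ _ (p * m) (q * t) =
      TensorR.mulSnd η (target B) q (TensorR.mulFst η (target B) p (RelTensor.tmul _ _ m t))
    rw [TensorR.mulFst_tmul, TensorR.mulSnd_tmul]
  | add X Y hX hY => simp only [mul_add, map_add, hX, hY]

@[simp] theorem embedTriple_tmul (X : TensorR η (target B)) (t : CentralSq B) :
    embedTriple hρ η j hj (RelTensor.tmul _ _ X t) =
      TensorB.act (TensorB.isRightAction_rmul B ρ) (embedR hρ η j hj X) (val B t) :=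
  embed_tmul _ _ _ X t

theorem embedTriple_injective {I : Type*} (Q : RightD2Quasibase B I)
    (hj' : Function.Injective j) : Function.Injective (embedTriple hρ η j hj) :=
  Q.embed_injective _ _ (embedR_right hρ η j hj) (Q.embed_injective hρ j hj hj')

/-- If `δ : M → M ⊗_R T` corresponds to `f : N → N ⊗_B A`, then `δ ⊗ id` corresponds to `f ⊗ id`. -/
theorem embedTriple_mapFst (δ : M →ₗ[k] TensorR η (target B))
    (hδ : ∀ m r, δ (m * η r) = TensorR.right η (source_mul_target B) r (δ m))
    (f : N →ₗ[k] TensorB B ρ) (hf : ∀ a n, f (ρ a n) = TensorB.rmul B ρ a (f n))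
    (hδf : ∀ m, embedR hρ η j hj (δ m) = f (j m)) (X : TensorR η (target B)) :
    embedTriple hρ η j hj (TensorR.mapFst η (source_mul_target B) δ hδ X) =
      TensorB.mapFst f (fun b _ => hf b) (embedR hρ η j hj X) := by
  have : embedTriple hρ η j hj ∘ₗ TensorR.mapFst η (source_mul_target B) δ hδ =
      TensorB.mapFst f (fun b _ => hf b) ∘ₗ embedR hρ η j hj :=
    RelTensor.hom_ext fun m t => by
      rw [LinearMap.comp_apply, LinearMap.comp_apply, embedR_tmul,
        TensorB.mapFst_act hρ (TensorB.isRightAction_rmul B ρ) f hf, ← hδf,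
        ← embedTriple_tmul hρ η j hj]
      exact congrArg _ (RelTensor.map_tmul _ _ _ _ m t)
  exact LinearMap.congr_fun this X

/-- `(x ⊗ y) ⊗ z ↦ (n x ⊗ y) ⊗ z`, for `n` in the right `A`-module `N`. -/
def TensorB.actFst (n : N) :
    TensorB B (rmul B (LinearMap.mulRight k)) →ₗ[k] TensorB B (rmul B ρ) :=
  mapFst (act hρ n) (fun b _ => act_rmul hρ n b)

@[simp] theorem TensorB.actFst_tmul (n : N) (z : TensorSq B) (a : A) :
    actFst hρ n (tmul B (rmul B (LinearMap.mulRight k)) z a) =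
      tmul B (rmul B ρ) (act hρ n z) a :=
  mapFst_tmul (ρ := rmul B (LinearMap.mulRight k)) (act hρ n) (fun b _ => act_rmul hρ n b) z a

theorem embedTriple_assocAt (m : M) (Z : TensorR (source B) (target B)) :
    embedTriple hρ η j hj (TensorR.assocAt η (source_mul_target B) m Z) =
      TensorB.actFst hρ (j m) (embedT B Z) := by
  have : embedTriple hρ η j hj ∘ₗ TensorR.assocAt η (source_mul_target B) m =
      TensorB.actFst hρ (j m) ∘ₗ embedT B :=
    RelTensor.hom_ext fun t u => by
      simp only [LinearMap.comp_apply, TensorR.assocAt_tmul, embedT_tmul,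
        embedTriple_tmul, embedR_tmul]
      exact (TensorB.mapFst_act _ (TensorB.isRightAction_rmul B ρ) (TensorB.act hρ (j m))
        (TensorB.act_rmul hρ (j m)) _ _).symm
  exact LinearMap.congr_fun this Z

/-- If `Δ` corresponds to `x ⊗ y ↦ x ⊗ 1 ⊗ y`, then `id ⊗ Δ` corresponds to
`n ⊗ a ↦ n ⊗ 1 ⊗ a`. -/
theorem embedTriple_mapSnd (Δ : CentralSq B →ₗ[k] TensorR (source B) (target B))
    (hΔl : ∀ x r, Δ (x * target B (op r)) = TensorR.left (source_mul_target B) r (Δ x))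
    (hΔ : ∀ t, embedT B (Δ t) = TensorB.insOne B (LinearMap.mulRight k) (val B t))
    (X : TensorR η (target B)) :
    embedTriple hρ η j hj (TensorR.mapSnd η (source_mul_target B) Δ hΔl X) =
      TensorB.insOne B ρ (embedR hρ η j hj X) := by
  have key (n : N) (z : TensorSq B) :
      TensorB.actFst hρ n (TensorB.insOne B (LinearMap.mulRight k) z) =
        TensorB.insOne B ρ (TensorB.act hρ n z) := by
    induction z using RelTensor.induction with
    | h0 => simp
    | ht x y => simp
    | ha x y hx hy => simp only [map_add, hx, hy]
  have : embedTriple hρ η j hj ∘ₗ TensorR.mapSnd η (source_mul_target B) Δ hΔl =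
      TensorB.insOne B ρ ∘ₗ embedR hρ η j hj :=
    RelTensor.hom_ext fun m t => by
      rw [LinearMap.comp_apply, LinearMap.comp_apply, embedR_tmul, ← key, ← hΔ,
        ← embedTriple_assocAt hρ η j hj]
      simp [TensorR.mapSnd, TensorR.assocBilin]
  exact LinearMap.congr_fun this X

variable (B) in
/-- The action map `N ⊗_B A → N`, `n ⊗ a ↦ n a`. -/
def TensorB.contract : TensorB B ρ →ₗ[k] N :=
  RelTensor.lift (LinearMap.mk₂ k (fun n a => ρ a n) (by simp) (by simp)
    (fun n a a' => hρ.map_add a a' n) (fun c n a => hρ.map_smul c a n))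
    (fun b n a => (hρ.map_mul b a n).symm)

@[simp] theorem TensorB.contract_tmul (n : N) (a : A) :
    TensorB.contract B hρ (TensorB.tmul B ρ n a) = ρ a n :=
  RelTensor.lift_tmul _ _ n a

theorem TensorB.contract_act (n : N) (z : TensorSq B) :
    TensorB.contract B hρ (TensorB.act hρ n z) = ρ (mult B z) n := by
  induction z using RelTensor.induction with
  | h0 => simpa using (hρ.map_smul 0 0 n).symm
  | ht x y => simp [hρ.map_mul]
  | ha x y hx hy => simp only [map_add, hx, hy, hρ.map_add]

theorem counit_mul_target (t : CentralSq B) (r : Cent B) :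
    counit B (t * target B (op r)) = r * counit B t :=
  Subtype.ext (by
    rw [coe_counit, val_mul_target, mult_lmul]
    rfl)

theorem counit_mul_source (t : CentralSq B) (r : Cent B) :
    counit B (t * source B r) = counit B t * r :=
  Subtype.ext (by
    rw [coe_counit, val_mul_source, mult_rmul]
    rfl)

theorem apply_counitSnd (X : TensorR η (target B)) :
    j (TensorR.counitSnd η (counit B) counit_mul_target X) =
      TensorB.contract B hρ (embedR hρ η j hj X) := by
  have : j ∘ₗ TensorR.counitSnd η (counit B) counit_mul_target =
      TensorB.contract B hρ ∘ₗ embedR hρ η j hj :=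
    RelTensor.hom_ext fun m t => by
      simp [TensorR.counitSnd, TensorB.contract_act, hj, coe_counit]
  exact LinearMap.congr_fun this X

variable (B) in
/-- `(x ⊗ y) ⊗ z ↦ x y ⊗ z`. -/
def TensorB.multFst : TensorB B (rmul B (LinearMap.mulRight k)) →ₗ[k] TensorSq B :=
  mapFst (ρ := rmul B (LinearMap.mulRight k)) (ρ' := LinearMap.mulRight k) (mult B)
    (fun b _ => mult_rmul B b)

@[simp] theorem TensorB.multFst_tmul (z : TensorSq B) (a : A) :
    multFst B (tmul B (rmul B (LinearMap.mulRight k)) z a) = TensorSq.tmul B (mult B z) a :=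
  mapFst_tmul (ρ := rmul B (LinearMap.mulRight k)) (ρ' := LinearMap.mulRight k) (mult B)
    (fun b _ => mult_rmul B b) z a

theorem val_counitFst (X : TensorR (source B) (target B)) :
    val B (TensorR.counitFst (target B) (counit B) counit_mul_source X) =
      TensorB.multFst B (embedT B X) := by
  have : val B ∘ₗ TensorR.counitFst (target B) (counit B) counit_mul_source =
      TensorB.multFst B ∘ₗ embedT B :=
    RelTensor.hom_ext fun t u => by
      simp only [LinearMap.comp_apply, embedT_tmul]
      refine Eq.trans ?_ (TensorB.mapFst_act _ isRightAction_mulRight (mult B)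
        (mult_rmul B) _ _).symm
      rw [TensorB.act_mulRight]
      simp [TensorR.counitFst, val_mul_target, coe_counit]
  exact LinearMap.congr_fun this X

end StructureMaps

/-! ### The bialgebroid and the comodule algebra of a quasibase -/

section Structures

open TensorSq CentralSq

variable {k A : Type*} [CommRing k] [Ring A] [Algebra k A] (B : Subalgebra k A)

/-- The map `A ⊗_R T → A ⊗_B A`, `a ⊗ t ↦ a t`. -/
def embedA : TensorR (Cent B).val (target B) →ₗ[k] TensorSq B :=
  embedR isRightAction_mulRight (Cent B).val LinearMap.id (fun _ _ => rfl)

theorem embedA_tmul (a : A) (t : CentralSq B) :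
    embedA B (RelTensor.tmul _ _ a t) = lmul B a (val B t) :=
  (embedR_tmul _ _ _ _ a t).trans (TensorB.act_mulRight a _)

theorem embedA_mulFst (a : A) (X : TensorR (Cent B).val (target B)) :
    embedA B (TensorR.mulFst _ _ a X) = lmul B a (embedA B X) := by
  have : embedA B ∘ₗ TensorR.mulFst _ _ a = lmul B a ∘ₗ embedA B :=
    RelTensor.hom_ext fun m t => by
      rw [LinearMap.comp_apply, TensorR.mulFst_tmul, LinearMap.comp_apply, embedA_tmul,
        embedA_tmul, lmul_lmul]
  exact LinearMap.congr_fun this X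

theorem embedA_mulSnd (q : CentralSq B) (X : TensorR (Cent B).val (target B)) :
    embedA B (TensorR.mulSnd _ _ q X) = sandwich (val B q) q.val_mem (embedA B X) := by
  have : embedA B ∘ₗ TensorR.mulSnd _ _ q = sandwich (val B q) q.val_mem ∘ₗ embedA B :=
    RelTensor.hom_ext fun m t => by
      rw [LinearMap.comp_apply, TensorR.mulSnd_tmul, LinearMap.comp_apply, embedA_tmul,
        embedA_tmul, val_mul, sandwich_lmul]
  exact LinearMap.congr_fun this X

/-- `x ⊗ y ↦ (x ⊗ 1) ⊗ y`. -/
abbrev insMid : TensorSq B →ₗ[k] TensorB B (TensorB.rmul B (LinearMap.mulRight k)) :=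
  TensorB.insOne B (LinearMap.mulRight k)

/-- The left `A`-action on `A ⊗_B A ⊗_B A`. -/
def TensorB.lmul (a : A) : Module.End k (TensorB B (rmul B (LinearMap.mulRight k))) :=
  mapFst (ρ := rmul B (LinearMap.mulRight k)) (ρ' := rmul B (LinearMap.mulRight k))
    (TensorSq.lmul B a) (fun b _ z => lmul_rmul B a b z)

@[simp] theorem TensorB.lmul_tmul (a : A) (z : TensorSq B) (b : A) :
    lmul B a (tmul B (rmul B (LinearMap.mulRight k)) z b) =
      tmul B (rmul B (LinearMap.mulRight k)) (TensorSq.lmul B a z) b :=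
  mapFst_tmul (ρ := rmul B (LinearMap.mulRight k)) (ρ' := rmul B (LinearMap.mulRight k))
    (TensorSq.lmul B a) (fun b _ z => lmul_rmul B a b z) z b

theorem insMid_lmul (a : A) (z : TensorSq B) :
    insMid B (lmul B a z) = TensorB.lmul B a (insMid B z) := by
  have : insMid B ∘ₗ lmul B a = TensorB.lmul B a ∘ₗ insMid B :=
    RelTensor.hom_ext fun x y => by simp
  exact LinearMap.congr_fun this z

theorem TensorB.act_lmul_left (a : A) (n z : TensorSq B) :
    act (isRightAction_rmul B (LinearMap.mulRight k)) (TensorSq.lmul B a n) z =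
      lmul B a (act (isRightAction_rmul B (LinearMap.mulRight k)) n z) := by
  induction z using RelTensor.induction with
  | h0 => simp
  | ht x y =>
    rw [act_tmul, act_tmul, lmul_tmul]
    exact congrArg (fun n => tmul B (rmul B (LinearMap.mulRight k)) n y)
      (lmul_rmul B a x n).symm
  | ha x y hx hy => simp only [map_add, hx, hy]

theorem embedT_mulSnd (q : CentralSq B) (X : TensorR (source B) (target B)) :
    embedT B (TensorR.mulSnd _ _ q X) = TensorB.sandwich
      (TensorB.isRightAction_rmul B (LinearMap.mulRight k)) (val B q) q.val_mem (embedT B X) :=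
  embedR_mulSnd _ _ _ _ q X

/-- `(x ⊗ y) ⊗ z ↦ (x · p · y) ⊗ z` on `A ⊗_B A ⊗_B A`, for `p ∈ T`. -/
def TensorB.sandwichFst (p : CentralSq B) :
    Module.End k (TensorB B (rmul B (LinearMap.mulRight k))) :=
  mapFst (ρ := rmul B (LinearMap.mulRight k)) (ρ' := rmul B (LinearMap.mulRight k))
    (TensorSq.sandwich (val B p) p.val_mem) (fun b _ z => sandwich_rmul _ p.val_mem b z)

@[simp] theorem TensorB.sandwichFst_tmul (p : CentralSq B) (z : TensorSq B) (a : A) :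
    sandwichFst B p (tmul B (rmul B (LinearMap.mulRight k)) z a) =
      tmul B (rmul B (LinearMap.mulRight k)) (TensorSq.sandwich (val B p) p.val_mem z) a :=
  mapFst_tmul (ρ := rmul B (LinearMap.mulRight k)) (ρ' := rmul B (LinearMap.mulRight k))
    (TensorSq.sandwich (val B p) p.val_mem) (fun b _ z => sandwich_rmul _ p.val_mem b z) z a

theorem embedT_mulFst (p : CentralSq B) (X : TensorR (source B) (target B)) :
    embedT B (TensorR.mulFst _ _ p X) = TensorB.sandwichFst B p (embedT B X) :=
  embedR_mulFst _ _ _ (fun r t => val_mul_source B t r) p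
    (TensorSq.sandwich (val B p) p.val_mem) (sandwich_rmul _ p.val_mem) (val_mul B p) X

theorem embedT_left (r : Cent B) (X : TensorR (source B) (target B)) :
    embedT B (TensorR.left (source_mul_target B) r X) = TensorB.lmul B r (embedT B X) := by
  have : embedT B ∘ₗ TensorR.left (source_mul_target B) r = TensorB.lmul B r ∘ₗ embedT B :=
    RelTensor.hom_ext fun t u => by
      rw [LinearMap.comp_apply, TensorR.left_tmul, LinearMap.comp_apply, embedT_tmul,
        embedT_tmul, val_mul_target, TensorB.act_lmul_left]
  exact LinearMap.congr_fun this X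

/-- The image of `X Y` in `A ⊗_B A ⊗_B A` depends on `Y ∈ T ⊗ T` only through its image. If the
latter is `a ⊗ 1 ⊗ c`, then the image of `X Y` is `a X c`. -/
theorem exists_embedT_mk_mul (X : CentralSq B ⊗[k] CentralSq B) :
    ∃ W : Module.End k (TensorB B (TensorB.rmul B (LinearMap.mulRight k))),
      (∀ Y, embedT B (RelTensor.mk _ _ (X * Y)) = W (embedT B (RelTensor.mk _ _ Y))) ∧
      ∀ a c, W (insMid B (tmul B a c)) =
        TensorB.rmul B _ c (TensorB.lmul B a (embedT B (RelTensor.mk _ _ X))) := by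
  induction X with
  | zero => exact ⟨0, by simp, by simp⟩
  | tmul p q =>
    refine ⟨TensorB.sandwich (TensorB.isRightAction_rmul B _) (val B q) q.val_mem ∘ₗ
      TensorB.sandwichFst B p, fun Y => ?_, fun a c => ?_⟩
    · rw [TensorR.mk_tmul_mul, embedT_mulSnd, embedT_mulFst, LinearMap.comp_apply]
    · rw [LinearMap.comp_apply, TensorB.insOne_tmul, TensorB.sandwichFst_tmul,
        TensorB.sandwich_tmul, sandwich_tmul, rmul_one, TensorB.act_lmul_left]
      exact congrArg (fun z => TensorB.rmul B _ c (TensorB.lmul B a z)) (embedT_tmul p q).symm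
  | add X X' hX hX' =>
    obtain ⟨W, hW, hWX⟩ := hX
    obtain ⟨W', hW', hWX'⟩ := hX'
    exact ⟨W + W', by simp only [add_mul, map_add, hW, hW', LinearMap.add_apply, implies_true],
      by simp only [map_add, hWX, hWX', LinearMap.add_apply, implies_true]⟩

namespace RightD2Quasibase

variable {B} {I : Type*} (Q : RightD2Quasibase B I)

theorem embedA_injective {I : Type*} (Q : RightD2Quasibase B I) :
    Function.Injective (embedA B) :=
  embed_injective _ _ (fun _ _ => rfl) Q Function.injective_id

theorem embedT_injective {I : Type*} (Q : RightD2Quasibase B I) :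
    Function.Injective (embedT B) :=
  embed_injective _ _ (fun r t => val_mul_source B t r) Q (val_injective B)

/-- The coaction is the element of `A ⊗_R T` that corresponds to `1 ⊗ a`. -/
theorem embedA_coaction (a : A) : embedA B (Q.coaction a) = tmul B 1 a := by
  refine (map_finsum (embedA B) ((Q.finite a).subset fun i hi h0 => hi ?_)).trans ?_
  · simp [h0]
  · rw [Q.sum_eq]
    exact finsum_congr fun i => by rw [embedA_tmul, one_mul]

/-- The coproduct is the element of `T ⊗_R T` that corresponds to `t¹ ⊗ 1 ⊗ t²`. -/
theorem embedT_comul (t : CentralSq B) : embedT B (Q.comul t) = insMid B (val B t) := by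
  have hρ := TensorB.isRightAction_rmul B (LinearMap.mulRight k : A → Module.End k A)
  have key (z : TensorSq B) :
      ∑ᶠ i, TensorB.act hρ (Q.idTensor i z) (val B (Q.u i)) = insMid B z := by
    have hfin (z : TensorSq B) :
        (Function.support fun i => TensorB.act hρ (Q.idTensor i z) (val B (Q.u i))).Finite :=
      (Q.idTensor_finite z).subset fun i hi h0 => hi (by simp [h0])
    induction z using RelTensor.induction with
    | h0 => simp
    | ht x y =>
      rw [TensorB.insOne_tmul, ← Q.finsum_act hρ]
      exact finsum_congr fun i => by rw [idTensor_tmul, TensorB.rmul_tmul, one_mul]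
    | ha x y hx hy =>
      simp only [map_add, LinearMap.add_apply]
      rw [finsum_add_distrib (hfin x) (hfin y), hx, hy]
  refine (map_finsum (embedT B) ((Q.idTensorT_finite t).subset fun i hi h0 => hi ?_)).trans ?_
  · simp [h0]
  · rw [← key]
    exact finsum_congr fun i => embedT_tmul _ _

/-- `z¹ t¹ t² z²` depends on `t ∈ T` only through `t¹ t²`. -/
theorem mult_sandwich (t z : TensorSq B) (ht : t ∈ central B) (t' : TensorSq B)
    (ht' : t' ∈ central B) (h : mult B t = mult B t') :
    mult B (sandwich t ht z) = mult B (sandwich t' ht' z) := by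
  induction z using RelTensor.induction with
  | h0 => simp
  | ht x y => simp only [sandwich_tmul, mult_lmul, mult_rmul, h]
  | ha x y hx hy => simp only [map_add, hx, hy]

theorem comul_left (x : CentralSq B) (r : Cent B) :
    Q.comul (x * target B (op r)) = TensorR.left (source_mul_target B) r (Q.comul x) :=
  Q.embedT_injective <| by
    rw [embedT_left, embedT_comul, embedT_comul, val_mul_target, insMid_lmul]

theorem comul_right (x : CentralSq B) (r : Cent B) :
    Q.comul (x * source B r) = TensorR.right (source B) (source_mul_target B) r (Q.comul x) :=
  Q.embedT_injective <| by
    refine Eq.trans ?_ (embedR_right _ _ _ _ r _).symm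
    refine Eq.trans ?_ (congrArg _ (Q.embedT_comul x).symm)
    rw [embedT_comul, val_mul_source]
    exact TensorB.insOne_rmul _ _

theorem coaction_right (a : A) (r : Cent B) :
    Q.coaction (a * r) = TensorR.right (Cent B).val (source_mul_target B) r (Q.coaction a) :=
  Q.embedA_injective <| by
    refine Eq.trans ?_ (embedR_right _ _ _ _ r _).symm
    refine Eq.trans ?_ (congrArg _ (Q.embedA_coaction a).symm)
    rw [embedA_coaction, TensorB.rmul_tmul]

/-- Both sides correspond to `x¹ ⊗ 1 ⊗ 1 ⊗ x²`. -/
theorem comul_coassoc (x : CentralSq B) :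
    TensorR.mapFst (source B) (source_mul_target B) Q.comul Q.comul_right (Q.comul x) =
      TensorR.mapSnd (source B) (source_mul_target B) Q.comul Q.comul_left (Q.comul x) := by
  refine embedTriple_injective (TensorB.isRightAction_rmul B (LinearMap.mulRight k)) _ (val B)
    (fun r t => val_mul_source B t r) Q (val_injective B) ?_
  refine (embedTriple_mapFst _ _ _ (fun r t => val_mul_source B t r) Q.comul Q.comul_right
    (insMid B) TensorB.insOne_rmul Q.embedT_comul _).trans ?_
  refine Eq.trans ?_ (embedTriple_mapSnd _ _ _ (fun r t => val_mul_source B t r) Q.comul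
    Q.comul_left Q.embedT_comul _).symm
  change TensorB.mapFst (insMid B) _ (embedT B (Q.comul x)) =
    TensorB.insOne B _ (embedT B (Q.comul x))
  rw [embedT_comul]
  induction val B x using RelTensor.induction with
  | h0 => simp only [map_zero]
  | ht x y => simp only [TensorB.insOne_tmul, TensorB.mapFst_tmul]
  | ha x y hx hy => simp only [map_add, hx, hy]

/-- Both sides correspond to `x¹ ⊗ r ⊗ x²`. -/
theorem comul_takeuchi (r : Cent B) (x : CentralSq B) :
    TensorR.mulFst (source B) (target B) (source B r) (Q.comul x) =
      TensorR.mulSnd (source B) (target B) (target B (op r)) (Q.comul x) :=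
  Q.embedT_injective <| by
    rw [embedT_mulFst, embedT_mulSnd, embedT_comul]
    induction val B x using RelTensor.induction with
    | h0 => simp only [map_zero]
    | ht a c =>
      rw [TensorB.insOne_tmul, TensorB.sandwichFst_tmul, TensorB.sandwich_tmul]
      refine Eq.trans ?_ (congrArg _ (TensorB.act_tmul _ _ _ _).symm)
      rw [TensorB.rmul_tmul, TensorB.rmul_tmul, sandwich_tmul, rmul_one, one_mul, one_mul]
      exact congrArg (fun n => TensorB.tmul B (TensorB.rmul B (LinearMap.mulRight k)) n c)
        ((lmul_tmul B a 1 (r : A)).trans (by rw [mul_one]; rfl))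
    | ha x y hx hy => simp only [map_add, hx, hy]

theorem comul_mul (x y : CentralSq B) (X Y : CentralSq B ⊗[k] CentralSq B)
    (hX : RelTensor.mk _ _ X = Q.comul x) (hY : RelTensor.mk _ _ Y = Q.comul y) :
    Q.comul (x * y) = RelTensor.mk _ _ (X * Y) := by
  refine Q.embedT_injective ?_
  obtain ⟨W, hW, hW'⟩ := exists_embedT_mk_mul B X
  rw [hW, hY, embedT_comul, embedT_comul, val_mul]
  induction val B y using RelTensor.induction with
  | h0 => simp only [map_zero]
  | ht a c =>
    rw [hW', hX, embedT_comul, sandwich_tmul, ← insMid_lmul, ← TensorB.insOne_rmul, lmul_rmul]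
    rfl
  | ha y z hy hz => simp only [map_add, hy, hz]

theorem isRightBialgebroid :
    IsRightBialgebroid (source B) (target B) Q.comul (counit B) where
  comm := source_mul_target B
  comul_left := Q.comul_left
  comul_right := Q.comul_right
  counit_left := counit_mul_target
  counit_right := counit_mul_source
  coassoc := Q.comul_coassoc
  counit_comul x := val_injective B <| by
    rw [val_counitFst, embedT_comul]
    induction val B x using RelTensor.induction with
    | h0 => simp
    | ht x y => simp
    | ha x y hx hy => simp only [map_add, hx, hy]
  comul_counit x := val_injective B <| by
    refine (apply_counitSnd (TensorB.isRightAction_rmul B _) _ _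
      (fun r t => val_mul_source B t r) _).trans ?_
    refine (congrArg _ (Q.embedT_comul x)).trans ?_
    induction val B x using RelTensor.induction with
    | h0 => simp
    | ht x y => simp
    | ha x y hx hy => simp only [map_add, hx, hy]
  counit_one := Subtype.ext (by rw [coe_counit, val_one, mult_tmul, one_mul]; rfl)
  comul_one := Q.embedT_injective (by
    rw [embedT_comul, val_one]
    simp [val_one])
  takeuchi := Q.comul_takeuchi
  comul_mul := Q.comul_mul
  counit_mul_source x y := Subtype.ext (by
    simp only [coe_counit, val_mul]
    refine mult_sandwich _ _ _ _ _ ?_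
    exact (one_mul _).symm.trans (mult_tmul B _ _).symm)
  counit_mul_target x y := Subtype.ext (by
    simp only [coe_counit, val_mul]
    refine mult_sandwich _ _ _ _ _ ?_
    exact (mul_one _).symm.trans (mult_tmul B _ _).symm)

/-- Both sides correspond to `1 ⊗ 1 ⊗ a`. -/
theorem coaction_coassoc (a : A) :
    TensorR.mapFst (Cent B).val (source_mul_target B) Q.coaction Q.coaction_right (Q.coaction a) =
      TensorR.mapSnd (Cent B).val (source_mul_target B) Q.comul Q.comul_left (Q.coaction a) := by
  refine embedTriple_injective isRightAction_mulRight _ LinearMap.id (fun _ _ => rfl) Q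
    Function.injective_id ?_
  refine (embedTriple_mapFst isRightAction_mulRight _ LinearMap.id (fun _ _ => rfl) Q.coaction
    Q.coaction_right (RelTensor.mkBilin _ _ 1)
    (fun a n => (rmul_tmul B a 1 n).symm) Q.embedA_coaction _).trans ?_
  refine Eq.trans ?_ (embedTriple_mapSnd isRightAction_mulRight _ LinearMap.id (fun _ _ => rfl)
    Q.comul Q.comul_left Q.embedT_comul _).symm
  change TensorB.mapFst (RelTensor.mkBilin _ _ 1) _ (embedA B (Q.coaction a)) =
    insMid B (embedA B (Q.coaction a))
  rw [embedA_coaction, TensorB.insOne_tmul]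
  exact TensorB.mapFst_tmul _ _ _ _

/-- Both sides correspond to `r ⊗ a`. -/
theorem coaction_takeuchi (r : Cent B) (a : A) :
    TensorR.mulFst (Cent B).val (target B) (r : A) (Q.coaction a) =
      TensorR.mulSnd (Cent B).val (target B) (target B (op r)) (Q.coaction a) :=
  Q.embedA_injective <| by
    rw [embedA_mulFst, embedA_mulSnd, embedA_coaction, sandwich_tmul, lmul_one, lmul_tmul,
      mul_one, val_target, rmul_tmul, one_mul]

theorem coaction_mul (a b : A) (X Y : A ⊗[k] CentralSq B)
    (hX : RelTensor.mk _ _ X = Q.coaction a) (hY : RelTensor.mk _ _ Y = Q.coaction b) :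
    Q.coaction (a * b) = RelTensor.mk _ _ (X * Y) := by
  refine Q.embedA_injective ?_
  have key : embedA B (RelTensor.mk _ _ (X * Y)) =
      rmul B b (embedA B (RelTensor.mk _ _ X)) := by
    clear hX
    induction X with
    | zero => simp
    | tmul p q =>
      rw [TensorR.mk_tmul_mul]
      rw [embedA_mulSnd, embedA_mulFst, hY, embedA_coaction, sandwich_lmul, sandwich_tmul,
        lmul_one, lmul_rmul]
      exact congrArg _ (embedA_tmul B p q).symm
    | add X X' hX hX' => simp only [add_mul, map_add, hX, hX']
  rw [key, hX, embedA_coaction, embedA_coaction, rmul_tmul]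

theorem isRightComoduleAlgebra :
    IsRightComoduleAlgebra Q.isRightBialgebroid (Cent B).val Q.coaction where
  right_linear := Q.coaction_right
  counit a := by
    refine (apply_counitSnd isRightAction_mulRight _ LinearMap.id (fun _ _ => rfl) _).trans ?_
    refine (congrArg _ (Q.embedA_coaction a)).trans ?_
    simp
  coassoc := Q.coaction_coassoc
  map_one := Q.embedA_injective (by
    rw [embedA_coaction, embedA_tmul, lmul_one, val_one])
  takeuchi := Q.coaction_takeuchi
  map_mul := Q.coaction_mul

/-- The Galois map is inverse to `a ⊗ t ↦ a t`. This needs no more of `B` than that it is the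
equalizer of `a ↦ 1 ⊗ a` and `a ↦ a ⊗ 1`. -/
theorem isGalois (hB : ∀ a, tmul B 1 a = tmul B a 1 → a ∈ B) :
    Q.isRightComoduleAlgebra.IsGalois B := by
  have hiff (a : A) : a ∈ B ↔ Q.coaction a = RelTensor.tmul _ _ a 1 := by
    rw [← Q.embedA_injective.eq_iff, embedA_coaction, embedA_tmul, val_one, lmul_tmul, mul_one]
    refine ⟨fun h => ?_, hB a⟩
    simpa using (one_mem (B := B) a h).symm
  refine ⟨hiff, ?_⟩
  have hleft (z : TensorSq B) : embedA B (Q.isRightComoduleAlgebra.galoisMap B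
      (fun b hb => (hiff b).1 hb) z) = z := by
    induction z using RelTensor.induction with
    | h0 => simp
    | ht x y =>
      rw [IsRightComoduleAlgebra.galoisMap, RelTensor.lift_tmul]
      refine (embedA_mulFst B x (Q.coaction y)).trans ?_
      rw [embedA_coaction, lmul_tmul, mul_one]
    | ha x y hx hy => simp only [map_add, hx, hy]
  exact ⟨Function.LeftInverse.injective hleft, fun X => ⟨embedA B X, Q.embedA_injective (hleft _)⟩⟩

end RightD2Quasibase

end Structures

/-! ### Depth two -/

section DepthTwo

open TensorSq CentralSq

/-- A right depth two extension has a quasibase: if `A ⊗_B A` is a direct summand of `A^(I)`, let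
`γ_i(a)` be the `i`-th coordinate of `1 ⊗ a` and `u_i` the image of the `i`-th basis vector. -/
theorem IsRightD2.exists_quasibase {k : Type u} {A : Type v} [CommRing k] [Ring A] [Algebra k A]
    {B : Subalgebra k A} (h : IsRightD2.{u, v, w} B) :
    ∃ I : Type w, Nonempty (RightD2Quasibase B I) := by
  obtain ⟨I, g, f, hgl, hgr, hfl, hfr, hfg⟩ := h
  have hf (i : I) (a : A) : f (Finsupp.single i a) = lmul B a (f (Finsupp.single i 1)) := by
    rw [← hfl]
    simp
  refine ⟨I, ⟨{
    γ := fun i => Finsupp.lapply i ∘ₗ g ∘ₗ RelTensor.mkBilin _ _ 1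
    map_left := fun i b hb a => ?_
    map_right := fun i b hb a => ?_
    u := fun i => ofMem (f (Finsupp.single i 1)) fun b hb => ?_
    finite := fun a => (g (tmul B 1 a)).hasFiniteSupport
    sum_eq := fun x y => ?_ }⟩⟩
  · change g (tmul B 1 (b * a)) i = b * g (tmul B 1 a) i
    have h : tmul B 1 (b * a) = lmul B b (tmul B 1 a) := by
      rw [lmul_tmul, mul_one]
      simpa using (RelTensor.tmul_balanced (fun b : B => LinearMap.mulRight k (b : A))
        (fun b : B => LinearMap.mulLeft k (b : A)) ⟨b, hb⟩ 1 a).symm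
    rw [h, hgl]
    simp
  · change g (tmul B 1 (a * b)) i = g (tmul B 1 a) i * b
    rw [← rmul_tmul, hgr b hb]
    simp
  · rw [← hf, ← hfr b hb]
    simp
  · change tmul B x y = ∑ᶠ i, lmul B (x * g (tmul B 1 y) i) (f (Finsupp.single i 1))
    have h : tmul B x y = lmul B x (f (g (tmul B 1 y))) := by
      rw [hfg, lmul_tmul, mul_one]
    conv_lhs => rw [h, ← Finsupp.sum_single (g (tmul B 1 y))]
    rw [Finsupp.sum, map_sum, map_sum, finsum_eq_sum_of_support_subset]
    · exact Finset.sum_congr rfl fun i _ => by rw [hf, lmul_lmul]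
    · intro i hi
      rw [Finset.mem_coe, Finsupp.mem_support_iff]
      intro h0
      exact hi (by simpa [h0] using lmul_smul B 0 0 (f (Finsupp.single i 1)))

variable {k : Type u} {A : Type v} {H : Type w} [CommRing k] [Ring A] [Algebra k A] [Ring H]
  [HopfAlgebra k H] {δ : A →ₐ[k] A ⊗[k] H} {B : Subalgebra k A}

theorem IsHopfExtension.galoisMap_tmul (hAB : IsHopfExtension δ B) (x y : A) :
    hAB.galoisMap (tmul B x y) = (x ⊗ₜ[k] (1 : H)) * δ y := by
  simp [galoisMap]

theorem rTensor_mulLeft (a : A) (z : A ⊗[k] H) :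
    (LinearMap.mulLeft k a).rTensor H z = (a ⊗ₜ[k] (1 : H)) * z := by
  induction z with
  | zero => simp
  | tmul x y => simp
  | add x y hx hy => simp only [map_add, mul_add, hx, hy]

theorem rTensor_mulRight (a : A) (z : A ⊗[k] H) :
    (LinearMap.mulRight k a).rTensor H z = z * (a ⊗ₜ[k] (1 : H)) := by
  induction z with
  | zero => simp
  | tmul x y => simp
  | add x y hx hy => simp only [map_add, add_mul, hx, hy]

theorem IsHopfExtension.galoisMap_lmul (hAB : IsHopfExtension δ B) (a : A) (z : TensorSq B) :
    hAB.galoisMap (lmul B a z) = (LinearMap.mulLeft k a).rTensor H (hAB.galoisMap z) := by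
  rw [rTensor_mulLeft]
  induction z using RelTensor.induction with
  | h0 => simp
  | ht x y =>
    rw [lmul_tmul, galoisMap_tmul, galoisMap_tmul, ← mul_assoc]
    simp
  | ha x y hx hy => simp only [map_add, mul_add, hx, hy]

theorem IsHopfExtension.galoisMap_rmul (hAB : IsHopfExtension δ B) {b : A} (hb : b ∈ B)
    (z : TensorSq B) :
    hAB.galoisMap (rmul B b z) = (LinearMap.mulRight k b).rTensor H (hAB.galoisMap z) := by
  rw [rTensor_mulRight]
  induction z using RelTensor.induction with
  | h0 => simp
  | ht x y =>
    rw [rmul_tmul, galoisMap_tmul, galoisMap_tmul, map_mul, (hAB.mem_iff b).1 hb, mul_assoc]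
  | ha x y hx hy => simp only [map_add, add_mul, hx, hy]

theorem lTensor_rTensor {P Q : Type*} [AddCommGroup P] [Module k P] [AddCommGroup Q] [Module k Q]
    (g : P →ₗ[k] Q) (φ : Module.End k A) (z : A ⊗[k] P) :
    g.lTensor A (φ.rTensor P z) = φ.rTensor Q (g.lTensor A z) := by
  rw [← LinearMap.comp_apply, LinearMap.lTensor_comp_rTensor, ← LinearMap.rTensor_comp_lTensor,
    LinearMap.comp_apply]

/-- If `H` is projective, then `A ⊗ H` is a direct summand of `A ⊗ k^(H) = A^(H)`. -/
theorem IsHopfExtension.IsSplitMono.isRightD2 [Module.Projective k H]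
    {hAB : IsHopfExtension δ B} (hβ : hAB.IsSplitMono) : IsRightD2.{u, v, w} B := by
  classical
  obtain ⟨σ, hσl, hσr, hσ⟩ := hβ
  obtain ⟨s, hs⟩ := Module.projective_def'.1 (inferInstance : Module.Projective k H)
  let e := TensorProduct.finsuppScalarRight k k A H
  have he (φ : Module.End k A) (z : A ⊗[k] (H →₀ k)) :
      e (φ.rTensor (H →₀ k) z) = Finsupp.mapRange.linearMap φ (e z) := by
    induction z with
    | zero => simp
    | tmul x c =>
      ext i
      simp [e, TensorProduct.finsuppScalarRight_apply_tmul_apply]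
    | add x y hx hy => simp only [map_add, hx, hy]
  have he' (φ : Module.End k A) (c : H →₀ A) :
      e.symm (Finsupp.mapRange.linearMap φ c) = φ.rTensor (H →₀ k) (e.symm c) := by
    rw [LinearEquiv.symm_apply_eq, he, LinearEquiv.apply_symm_apply]
  refine ⟨H, e.toLinearMap ∘ₗ s.lTensor A ∘ₗ hAB.galoisMap,
    σ ∘ₗ (Finsupp.linearCombination k id).lTensor A ∘ₗ e.symm.toLinearMap,
    fun a z => ?_, fun b hb z => ?_, fun a c => ?_, fun b hb c => ?_, fun z => ?_⟩
  · simp only [LinearMap.comp_apply, LinearEquiv.coe_coe, hAB.galoisMap_lmul, ← he,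
      lTensor_rTensor]
  · simp only [LinearMap.comp_apply, LinearEquiv.coe_coe, hAB.galoisMap_rmul hb, ← he,
      lTensor_rTensor]
  · simp only [LinearMap.comp_apply, LinearEquiv.coe_coe, he', ← hσl,
      lTensor_rTensor]
  · simp only [LinearMap.comp_apply, LinearEquiv.coe_coe, he', ← hσr b hb,
      lTensor_rTensor]
  · simp only [LinearMap.comp_apply, LinearEquiv.coe_coe, LinearEquiv.symm_apply_apply]
    rw [← LinearMap.lTensor_comp_apply, hs, LinearMap.lTensor_id,
      LinearMap.id_apply, hσ]

/-- The coinvariants are the `a` with `1 ⊗ a = a ⊗ 1` in `A ⊗_B A`: apply the Galois map. -/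
theorem IsHopfExtension.mem_of_tmul_eq (hAB : IsHopfExtension δ B) (a : A)
    (h : tmul B 1 a = tmul B a 1) : a ∈ B := by
  refine (hAB.mem_iff a).2 ?_
  have := congrArg hAB.galoisMap h
  rw [galoisMap_tmul, galoisMap_tmul, map_one, mul_one] at this
  rw [← this]
  exact (one_mul (δ a)).symm

end DepthTwo

theorem mainTheorem6 {k : Type u} {A : Type v} {H : Type w}
    [CommRing k] [Ring A] [Algebra k A] [Ring H] [HopfAlgebra k H] [Module.Projective k H]
    (δ : A →ₐ[k] A ⊗[k] H) (B : Subalgebra k A) (hAB : IsHopfExtension δ B)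
    (hβ : hAB.IsSplitMono) :
    IsRightD2.{u, v, w} B ∧
    (∃ I : Type w, Nonempty (RightD2Quasibase B I)) ∧
    ∃ (Δ : CentralSq B →ₗ[k] TensorR (CentralSq.source B) (CentralSq.target B))
      (δT : A →ₗ[k] TensorR (CentralSq.Cent B).val (CentralSq.target B)),
      (∀ (I : Type w) (Q : RightD2Quasibase B I), Δ = Q.comul ∧ δT = Q.coaction) ∧
      ∃ (hT : IsRightBialgebroid (CentralSq.source B) (CentralSq.target B) Δ (CentralSq.counit B))
        (hA : IsRightComoduleAlgebra hT (CentralSq.Cent B).val δT), hA.IsGalois B := by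
  have hD2 : IsRightD2.{u, v, w} B := hβ.isRightD2
  obtain ⟨I, ⟨Q⟩⟩ := hD2.exists_quasibase
  refine ⟨hD2, ⟨I, ⟨Q⟩⟩, Q.comul, Q.coaction, fun J Q' => ⟨?_, ?_⟩, Q.isRightBialgebroid,
    Q.isRightComoduleAlgebra, Q.isGalois hAB.mem_of_tmul_eq⟩
  -- The images of the two maps in `A ⊗_B A ⊗_B A` and `A ⊗_B A` do not involve the quasibase.
  · exact LinearMap.ext fun t =>
      Q.embedT_injective ((Q.embedT_comul t).trans (Q'.embedT_comul t).symm)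
  · exact LinearMap.ext fun a =>
      Q.embedA_injective ((Q.embedA_coaction a).trans (Q'.embedA_coaction a).symm)
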